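/- Let $(W,S)$ be a Coxeter system, $S=\{s_i\}_{i\in I}$ (finite or infinite), with Coxeter matrix $(m_{ij})_{i,j\in I}$, so $m_{ii}=1$ and $m_{ij}=m_{ji}\in\{2,3,\dots\}\cup\{\infty\}$ for $i\ne j$. Let $\Gamma$ be the graph with vertex set $S$ in which $s_i$ and $s_j$ ($i\neq j$) are joined by an edge if and only if $m_{ij}\ge 3$ (including $m_{ij}=\infty$). Let $\hat P_{W,S}=\mathbb{Q}\Gamma$ be its path algebra: the (possibly non-unital) $\mathbb{Q}$-algebra whose basis is the set of paths $[s_{i_0}s_{i_1}\dots s_{i_n}]$, $n\ge 0$, in $\Gamma$, two basis elements being multiplied by concatenation if the first path ends where the second one starts, and having product $0$ otherwise. For an integer $m\ge 3$ let $C_m(t)\in\mathbb{Z}[t]$ be the minimal polynomial of $4\cos^2(\pi/m)$. Let $\hat I_{W,S}$ be the two-sided ideal of $\hat P_{W,S}$ generated by the elements $C_{m_{ij}}([s_is_js_i])$, for all ordered pairs $(i,j)$ with $3\le m_{ij}<\infty$, the polynomial being evaluated in the ring $[s_i]\hat P_{W,S}[s_i]$, whose identity is $[s_i]$. Put $\hat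 R_{W,S}=\hat P_{W,S}/\hat I_{W,S}$, and write $[s_i]$ also for the image of the path of length zero $[s_i]$ in $\hat R_{W,S}$. Theorem. Let $i,j,k\in I$, and let $x_1\in[s_i]\hat R_{W,S}[s_j]$ and $x_2\in[s_j]\hat R_{W,S}[s_k]$ be such that $x_1x_2=0$. Then $x_1=0$ or $x_2=0$. -/

import Mathlib

noncomputable section

/-- A path of finite length (possibly zero) in a combinatorial graph `G`. The length zero paths are
the vertices, and a path is determined by the sequence of its vertices. -/
structure GraphPath {V : Type*} (G : SimpleGraph V) where
  source : V
  target : V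
  walk : G.Walk source target

namespace GraphPath

variable {V : Type*} {G : SimpleGraph V}

/-- The path of length zero at a vertex. -/
def vertex (v : V) : GraphPath G := ⟨v, v, SimpleGraph.Walk.nil⟩

/-- The path of length two running along an edge and back. -/
def backtrack {u v : V} (h : G.Adj u v) : GraphPath G :=
  ⟨u, u, SimpleGraph.Walk.cons h (SimpleGraph.Walk.cons h.symm SimpleGraph.Walk.nil)⟩

/-- Concatenation of two composable paths. -/
def concat (p q : GraphPath G) (h : p.target = q.source) : GraphPath G :=
  ⟨p.source, q.target, p.walk.append (q.walk.copy h.symm rfl)⟩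

theorem concat_assoc (p q r : GraphPath G) (h : p.target = q.source) (h' : q.target = r.source) :
    (p.concat q h).concat r h' = p.concat (q.concat r h') h := by
  obtain ⟨a, b, p⟩ := p
  obtain ⟨c, d, q⟩ := q
  obtain ⟨e, f, r⟩ := r
  dsimp only at h h'
  subst h h'
  simp [concat, SimpleGraph.Walk.append_assoc]

theorem vertex_concat (p : GraphPath G) : (vertex p.source).concat p rfl = p := rfl

theorem concat_vertex (p : GraphPath G) : p.concat (vertex p.target) rfl = p := by
  simp [concat, vertex]

end GraphPath

/-- The underlying module of the path algebra of the graph `G` over `A`: the free `A`-module on the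
set of paths of `G`. -/
def PathAlgebra (A : Type*) [CommRing A] {V : Type*} (G : SimpleGraph V) : Type _ :=
  GraphPath G →₀ A

namespace PathAlgebra

variable {A : Type*} [CommRing A] {V : Type*} {G : SimpleGraph V}

instance : AddCommGroup (PathAlgebra A G) := inferInstanceAs (AddCommGroup (GraphPath G →₀ A))

instance : Module A (PathAlgebra A G) := inferInstanceAs (Module A (GraphPath G →₀ A))

variable (A G) in
/-- The coefficients of an element of the path algebra in the basis of paths. -/
def coeffs : PathAlgebra A G ≃ₗ[A] (GraphPath G →₀ A) := LinearEquiv.refl A (GraphPath G →₀ A)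

/-- The element `a • p` of the path algebra, for a scalar `a` and a path `p`. -/
def single (p : GraphPath G) (a : A) : PathAlgebra A G :=
  (coeffs A G).symm (Finsupp.single p a)

open scoped Classical in
/-- The product of `a • p` and `b • q`: it is `(a * b) • pq` if `p` ends where `q` starts, and `0`
otherwise. -/
def mulSingle (p : GraphPath G) (a : A) (q : GraphPath G) (b : A) : PathAlgebra A G :=
  if h : p.target = q.source then single (p.concat q h) (a * b) else 0

/-- The multiplication of the path algebra is the bilinear extension of concatenation of paths. -/
instance : Mul (PathAlgebra A G) where
  mul f g := (coeffs A G f).sum fun p a => (coeffs A G g).sum fun q b => mulSingle p a q b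

theorem mul_def (f g : PathAlgebra A G) :
    f * g = (coeffs A G f).sum fun p a => (coeffs A G g).sum fun q b => mulSingle p a q b := rfl

theorem single_zero (p : GraphPath G) : single p (0 : A) = 0 := by
  simp [single]

theorem single_add (p : GraphPath G) (a b : A) : single p (a + b) = single p a + single p b := by
  simp [single]

theorem mulSingle_zero_left (p q : GraphPath G) (b : A) : mulSingle p 0 q b = 0 := by
  simp [mulSingle, single_zero]

theorem mulSingle_zero_right (p q : GraphPath G) (a : A) : mulSingle p a q 0 = 0 := by
  simp [mulSingle, single_zero]

theorem mulSingle_add_left (p q : GraphPath G) (a a' b : A) :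
    mulSingle p (a + a') q b = mulSingle p a q b + mulSingle p a' q b := by
  unfold mulSingle
  split_ifs <;> simp [add_mul, single_add]

theorem mulSingle_add_right (p q : GraphPath G) (a b b' : A) :
    mulSingle p a q (b + b') = mulSingle p a q b + mulSingle p a q b' := by
  unfold mulSingle
  split_ifs <;> simp [mul_add, single_add]

theorem single_mul_single (p q : GraphPath G) (a b : A) :
    single p a * single q b = mulSingle p a q b := by
  rw [mul_def, single, single, LinearEquiv.apply_symm_apply, LinearEquiv.apply_symm_apply,
    Finsupp.sum_single_index, Finsupp.sum_single_index]
  · exact mulSingle_zero_right p q a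
  · simp [mulSingle_zero_left, Finsupp.sum]

theorem mulSingle_of_eq (p q : GraphPath G) (a b : A) (h : p.target = q.source) :
    mulSingle p a q b = single (p.concat q h) (a * b) := dif_pos h

theorem mulSingle_of_ne (p q : GraphPath G) (a b : A) (h : p.target ≠ q.source) :
    mulSingle p a q b = 0 := dif_neg h

theorem induction_on {motive : PathAlgebra A G → Prop} (f : PathAlgebra A G) (zero : motive 0)
    (add : ∀ f g, motive f → motive g → motive (f + g))
    (single : ∀ p a, motive (single p a)) : motive f :=
  Finsupp.induction_linear f zero add single

instance : NonUnitalNonAssocRing (PathAlgebra A G) where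
  left_distrib f g h := by
    simp only [mul_def, map_add]
    rw [← Finsupp.sum_add]
    exact Finsupp.sum_congr fun p _ => Finsupp.sum_add_index'
      (fun q => mulSingle_zero_right p q _) (fun q b b' => mulSingle_add_right p q _ b b')
  right_distrib f g h := by
    simp only [mul_def, map_add]
    refine Finsupp.sum_add_index' (fun p => ?_) (fun p a a' => ?_)
    · simp [mulSingle_zero_left, Finsupp.sum]
    · simp [mulSingle_add_left, Finsupp.sum, Finset.sum_add_distrib]
  zero_mul f := by simp [mul_def]
  mul_zero f := by simp [mul_def, Finsupp.sum]

theorem single_mul_assoc (p q r : GraphPath G) (a b c : A) :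
    single p a * single q b * single r c = single p a * (single q b * single r c) := by
  have key : ∀ (x y : GraphPath G) (s t : A), single x s * single y t = mulSingle x s y t :=
    single_mul_single
  by_cases h : p.target = q.source <;> by_cases h' : q.target = r.source
  · have h₁ : (p.concat q h).target = r.source := h'
    have h₂ : p.target = (q.concat r h').source := h
    rw [key, key, mulSingle_of_eq _ _ _ _ h, mulSingle_of_eq _ _ _ _ h', key, key,
      mulSingle_of_eq _ _ _ _ h₁, mulSingle_of_eq _ _ _ _ h₂, mul_assoc]
    exact congrArg (fun x => single x _) (GraphPath.concat_assoc p q r h h')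
  · have h₁ : (p.concat q h).target ≠ r.source := h'
    rw [key, key, mulSingle_of_eq _ _ _ _ h, mulSingle_of_ne _ _ _ _ h', key,
      mulSingle_of_ne _ _ _ _ h₁, mul_zero]
  · have h₂ : p.target ≠ (q.concat r h').source := h
    rw [key, key, mulSingle_of_ne _ _ _ _ h, mulSingle_of_eq _ _ _ _ h', key,
      mulSingle_of_ne _ _ _ _ h₂, zero_mul]
  · rw [key, key, mulSingle_of_ne _ _ _ _ h, mulSingle_of_ne _ _ _ _ h', zero_mul, mul_zero]

/-- The path algebra is an associative ring; it is unital only if there are finitely many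
vertices. -/
instance : NonUnitalRing (PathAlgebra A G) where
  mul_assoc f g h := by
    induction f using induction_on with
    | zero => simp
    | add f f' hf hf' => simp [add_mul, hf, hf']
    | single p a =>
      induction g using induction_on with
      | zero => simp
      | add g g' hg hg' => simp [mul_add, add_mul, hg, hg']
      | single q b =>
        induction h using induction_on with
        | zero => simp
        | add h h' hh hh' => simp [mul_add, hh, hh']
        | single r c => exact single_mul_assoc p q r a b c

variable (A) in
/-- The element of the path algebra given by the length zero path at `v`. -/
def vertex (v : V) : PathAlgebra A G := single (GraphPath.vertex v) 1

theorem isIdempotentElem_vertex (v : V) : IsIdempotentElem (vertex A v : PathAlgebra A G) := by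
  unfold IsIdempotentElem vertex
  rw [single_mul_single, mulSingle_of_eq _ _ _ _ rfl, mul_one]
  rfl

variable (A) in
/-- The element `y * ȳ = [uvu]` of the path algebra, for an edge `y = [uv]`. -/
def backtrack {u v : V} (h : G.Adj u v) : PathAlgebra A G := single (GraphPath.backtrack h) 1

theorem backtrack_mem_corner {u v : V} (h : G.Adj u v) :
    backtrack A h ∈ Subsemigroup.corner (vertex A u : PathAlgebra A G) := by
  rw [Subsemigroup.mem_corner_iff (isIdempotentElem_vertex u)]
  unfold vertex backtrack
  constructor
  · rw [single_mul_single, mulSingle_of_eq _ _ _ _ rfl, mul_one]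
    rfl
  · rw [single_mul_single, mulSingle_of_eq _ _ _ _ rfl, mul_one]
    rfl

variable (A) in
/-- The element `[uvu]`, as an element of the unital ring `[u] P [u]` with identity `[u]`. -/
def cornerBacktrack {u v : V} (h : G.Adj u v) :
    (isIdempotentElem_vertex u : IsIdempotentElem (vertex A u : PathAlgebra A G)).Corner :=
  ⟨backtrack A h, backtrack_mem_corner h⟩

/-- The value `f([uvu])` of an integer polynomial `f`, evaluated in the ring `[u] P [u]`, whose
identity is `[u]`, and then regarded as an element of the path algebra `P`. -/
def evalBacktrack {u v : V} (h : G.Adj u v) (f : Polynomial ℤ) : PathAlgebra A G :=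
  (Polynomial.aeval (cornerBacktrack A h) f).val

end PathAlgebra

/-- The minimal polynomial of `4 cos² (π / m)` in `ℤ[t]`. -/
def cosPoly (m : ℕ) : Polynomial ℤ := minpoly ℤ (4 * Real.cos (Real.pi / m) ^ 2)

namespace CoxeterMatrix

variable {B : Type*} (M : CoxeterMatrix B)

/-- The graph of a Coxeter matrix: vertices `i ≠ j` are joined by an edge if and only if
`3 ≤ m i j ≤ ∞`. Recall that the entry `0` of a `CoxeterMatrix` stands for `∞`. -/
def graph : SimpleGraph B where
  Adj i j := i ≠ j ∧ (3 ≤ M i j ∨ M i j = 0)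
  symm := ⟨fun i j h => ⟨h.1.symm, by rw [M.symmetric j i]; exact h.2⟩⟩
  loopless := ⟨fun _ h => h.1 rfl⟩

theorem graph_adj_of_three_le {i j : B} (h : 3 ≤ M i j) : M.graph.Adj i j :=
  ⟨by rintro rfl; simp at h, Or.inl h⟩

variable (A : Type*) [CommRing A]

/-- The relations `C_m([s_i s_j s_i])` with `m = m i j`, one for each (oriented) edge `[s_i s_j]`
with `3 ≤ m i j < ∞`. -/
def relations : Set (PathAlgebra A M.graph) :=
  {x | ∃ (i j : B) (h : 3 ≤ M i j),
    x = PathAlgebra.evalBacktrack (M.graph_adj_of_three_le h) (cosPoly (M i j))}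

/-- The two-sided ideal of the path algebra generated by the relations. -/
def relIdeal : TwoSidedIdeal (PathAlgebra A M.graph) := TwoSidedIdeal.span (M.relations A)

/-- The strict universal coefficient ring with coefficients in `A`: the quotient of the path algebra
over `A` of the graph of `M` by the ideal generated by the relations. For `A = ℤ` it is the ring `R`
and for `A = ℚ` it is its rational form. -/
abbrev CoeffRing : Type _ := (M.relIdeal A).ringCon.Quotient

/-- The idempotent `[s_i]` of the quotient ring. -/
def idem (i : B) : M.CoeffRing A := ((PathAlgebra.vertex A i : PathAlgebra A M.graph) : M.CoeffRing A)

/-- The subset `[s_i] R [s_j]` of the quotient ring `R`. -/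
def piece (i j : B) : Set (M.CoeffRing A) := {x | ∃ r, x = M.idem A i * r * M.idem A j}

end CoxeterMatrix

end

/-! The idea is to map the path algebra to a domain so that the quotient embeds piece by piece. The
target is a ring of power series in noncommuting variables over a commutative domain, where moving a
coefficient past a variable applies an injective endomorphism. Comparing shortest words shows that
it has no zero divisors (`SkewSeries.eq_zero_or_eq_zero_of_mul_eq_zero`).

There is a variable for every oriented edge `(i, j)` and every `t` in an index set `T`. With `g i j`
the inverse of `1 - ∑ x`, the sum running over the variables of `(i, j)`, the edge from `i` to `j`
is sent to `g i j * b i j * (g j i)⁻¹`. Running back and forth along an edge telescopes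
(`pathSeries_alternating_append`), so `[iji]` goes to a conjugate of `(b i j)²`. The relations
therefore die once `(b i j)²` is a root of the polynomial `C_m`.

Since the relations are monic, every class is represented by a combination of reduced paths, those
not running `2 deg C_m` times along an edge (`mem_reducible`). It remains to show that the series of
reduced paths with common endpoints are linearly independent
(`eq_zero_of_sum_pathSeries_apply_eq_zero`). A path splits into maximal runs along single edges, and
a run of length `m` contributes a series in the variables of one unoriented edge, its colour. On
words with as many colour blocks as the path has runs, the coefficients factor run by run. Two
letters with the same `t` read off the image of `b ^ m` under the endomorphism `τ t`. Varying `t`, a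
Vandermonde argument (`sum_filter_eq_zero_of_sum_pow_eq`) separates the run lengths, provided that
`b²` has `deg C_m` distinct images, or arbitrarily many if `m = ∞`.

The polynomial ring in `X` over an algebraic closure of `ℚ`, with all its injective endomorphisms,
provides this: `b` is a constant whose square is a root of the irreducible `C_m`, and Galois
automorphisms move the square to all conjugates; for `m = ∞` one takes `b = X` and substitutes
powers of `X` (`exists_separated_coefficient`). -/

noncomputable section

/-! ### Skew power series over a domain -/

/-- Formal power series in noncommuting variables `x s`, for `s : S`, whose coefficients in `R` are
written to the right of the words and satisfy `a * x s = x s * τ s a`. -/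
def SkewSeries {S R : Type*} [CommRing R] (_τ : S → R →+* R) : Type _ := List S → R

namespace SkewSeries

variable {S R : Type*} [CommRing R] {τ : S → R →+* R}

instance : AddCommGroup (SkewSeries τ) := inferInstanceAs (AddCommGroup (List S → R))

@[ext] theorem ext {u v : SkewSeries τ} (h : ∀ w : List S, u w = v w) : u = v := funext h

@[simp] theorem zero_apply (w : List S) : (0 : SkewSeries τ) w = 0 := rfl
@[simp] theorem add_apply (u v : SkewSeries τ) (w : List S) : (u + v) w = u w + v w := rfl

variable (τ) in
/-- The endomorphism by which coefficients change when they are moved past a word. -/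
def twist : List S → R →+* R
  | [] => RingHom.id R
  | s :: w => (twist w).comp (τ s)

@[simp] theorem twist_nil (a : R) : twist τ [] a = a := rfl
@[simp] theorem twist_cons (s : S) (w : List S) (a : R) :
    twist τ (s :: w) a = twist τ w (τ s a) := rfl

theorem twist_injective (hτ : ∀ s, Function.Injective (τ s)) (w : List S) :
    Function.Injective (twist τ w) := by
  induction w with
  | nil => exact fun _ _ h => h
  | cons s w ih => exact ih.comp (hτ s)

/-- The left derivative, which removes the initial letter `s`. -/
def deriv (s : S) (u : SkewSeries τ) : SkewSeries τ := fun w => u (s :: w)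

@[simp] theorem deriv_apply (s : S) (u : SkewSeries τ) (w : List S) : deriv s u w = u (s :: w) :=
  rfl

/-- The coefficient of the product of `u` and `v` at a word. -/
def mulCoeff (v : SkewSeries τ) : List S → SkewSeries τ → R
  | [], u => u [] * v []
  | s :: w, u => twist τ (s :: w) (u []) * v (s :: w) + mulCoeff v w (deriv s u)

instance : Mul (SkewSeries τ) := ⟨fun u v w => mulCoeff v w u⟩

theorem mul_nil (u v : SkewSeries τ) : (u * v) [] = u [] * v [] := rfl

/-- Either `u` contributes the empty word and its constant term moves past the whole word, or it
contributes a word starting with `s`. -/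
theorem mul_cons (u v : SkewSeries τ) (s : S) (w : List S) :
    (u * v) (s :: w) = twist τ (s :: w) (u []) * v (s :: w) + (deriv s u * v) w := rfl

variable (τ) in
/-- The constant series. -/
def const (a : R) : SkewSeries τ
  | [] => a
  | _ :: _ => 0

@[simp] theorem const_nil (a : R) : const τ a [] = a := rfl
@[simp] theorem const_cons (a : R) (s : S) (w : List S) : const τ a (s :: w) = 0 := rfl

instance : One (SkewSeries τ) := ⟨const τ 1⟩

theorem one_def : (1 : SkewSeries τ) = const τ 1 := rfl

theorem deriv_add (s : S) (u v : SkewSeries τ) : deriv s (u + v) = deriv s u + deriv s v := rfl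

@[simp] theorem deriv_const (s : S) (a : R) : deriv s (const τ a) = 0 := rfl

@[simp] theorem deriv_zero (s : S) : deriv s (0 : SkewSeries τ) = 0 := rfl

protected theorem zero_mul' (v : SkewSeries τ) : 0 * v = 0 := by
  ext w
  induction w with
  | nil => simp [mul_nil]
  | cons s w ih => simp [mul_cons, ih]

protected theorem add_mul' (u u' v : SkewSeries τ) : (u + u') * v = u * v + u' * v := by
  ext w
  induction w generalizing u u' with
  | nil => simp [mul_nil, add_mul]
  | cons s w ih => simp [mul_cons, deriv_add, ih, add_mul]; ring

theorem const_mul_apply (a : R) (v : SkewSeries τ) (w : List S) :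
    (const τ a * v) w = twist τ w a * v w := by
  cases w with
  | nil => rfl
  | cons s w => simp [mul_cons, SkewSeries.zero_mul']

theorem deriv_mul (s : S) (u v : SkewSeries τ) :
    deriv s (u * v) = const τ (τ s (u [])) * deriv s v + deriv s u * v := by
  ext w
  simp [mul_cons, const_mul_apply]

/-- The case of associativity needed in the induction for the general law, because `deriv_mul`
produces a constant left factor. -/
theorem const_mul_mul_apply (a : R) (v z : SkewSeries τ) (w : List S) :
    (const τ a * v * z) w = twist τ w a * (v * z) w := by
  induction w generalizing a v with
  | nil => simp [mul_nil, mul_assoc]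
  | cons s w ih =>
    rw [mul_cons, deriv_mul, deriv_const, SkewSeries.zero_mul', add_zero, mul_cons, ih]
    simp [mul_nil]
    ring

instance : Ring (SkewSeries τ) where
  __ := (inferInstance : AddCommGroup (SkewSeries τ))
  left_distrib u v z := by
    ext w
    induction w generalizing u with
    | nil => simp [mul_nil, mul_add]
    | cons s w ih => simp [mul_cons, ih, mul_add]; ring
  right_distrib := SkewSeries.add_mul'
  zero_mul := SkewSeries.zero_mul'
  mul_zero u := by
    ext w
    induction w generalizing u with
    | nil => simp [mul_nil]
    | cons s w ih => simp [mul_cons, ih]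
  mul_assoc u v z := by
    ext w
    induction w generalizing u with
    | nil => simp [mul_nil, mul_assoc]
    | cons s w ih =>
      rw [mul_cons, deriv_mul, SkewSeries.add_mul', add_apply, ih, const_mul_mul_apply,
        mul_cons _ (v * z), mul_cons v z, mul_nil, map_mul, mul_add, twist_cons]
      ring
  one_mul v := by
    ext w
    simp [one_def, const_mul_apply]
  mul_one u := by
    ext w
    induction w generalizing u with
    | nil => simp [mul_nil, one_def]
    | cons s w ih => rw [mul_cons, ih]; simp [one_def]

theorem apply_sum {ι : Type*} (T : Finset ι) (F : ι → SkewSeries τ) (w : List S) :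
    (∑ i ∈ T, F i) w = ∑ i ∈ T, F i w := by
  classical
  induction T using Finset.induction_on with
  | empty => rfl
  | insert a s ha ih => rw [Finset.sum_insert ha, Finset.sum_insert ha, add_apply, ih]

theorem const_mul_const (a b : R) : const τ a * const τ b = const τ (a * b) := by
  ext w
  rw [const_mul_apply]
  cases w <;> simp

variable (τ) in
/-- The ring homomorphism embedding the coefficients as constant series. -/
def constHom : R →+* SkewSeries τ where
  toFun := const τ
  map_one' := rfl
  map_mul' a b := (const_mul_const a b).symm
  map_zero' := by ext w; cases w <;> rfl
  map_add' a b := by ext w; cases w <;> simp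

theorem mul_apply_eq_zero_of_length_lt {v : SkewSeries τ} {n : ℕ}
    (hv : ∀ w : List S, w.length < n → v w = 0) (u : SkewSeries τ) (w : List S)
    (hw : w.length < n) : (u * v) w = 0 := by
  induction w generalizing u with
  | nil => simp [mul_nil, hv _ hw]
  | cons s w ih =>
    rw [mul_cons, hv _ hw, ih _ (by simp at hw; omega)]
    simp

/-- Any other splitting of `w₁ ++ w₂` gives one of the factors a word that is too short. Only
lengths are compared, so the variables need no order. -/
theorem mul_apply_append {u v : SkewSeries τ} (w₁ w₂ : List S)
    (hu : ∀ w : List S, w.length < w₁.length → u w = 0)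
    (hv : ∀ w : List S, w.length < w₂.length → v w = 0) :
    (u * v) (w₁ ++ w₂) = twist τ w₂ (u w₁) * v w₂ := by
  induction w₁ generalizing u with
  | nil =>
    cases w₂ with
    | nil => rfl
    | cons s w =>
      rw [List.nil_append, mul_cons, mul_apply_eq_zero_of_length_lt hv _ _ (by simp), add_zero]
  | cons s w₁ ih =>
    rw [List.cons_append, mul_cons, hu [] (by simp), map_zero, zero_mul, zero_add,
      ih (u := deriv s u) fun w hw => hu (s :: w) (by simpa using hw), deriv_apply]

theorem exists_shortest {u : SkewSeries τ} (hu : u ≠ 0) :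
    ∃ w : List S, u w ≠ 0 ∧ ∀ w' : List S, w'.length < w.length → u w' = 0 := by
  classical
  have : ∃ n, ∃ w : List S, w.length = n ∧ u w ≠ 0 := by
    by_contra! h
    exact hu (ext fun w => h _ w rfl)
  obtain ⟨w, hw, hw'⟩ := Nat.find_spec this
  refine ⟨w, hw', fun w' h => ?_⟩
  by_contra h'
  exact Nat.find_min this (hw ▸ h) ⟨w', rfl, h'⟩

theorem eq_zero_or_eq_zero_of_mul_eq_zero [IsDomain R] (hτ : ∀ s, Function.Injective (τ s))
    {u v : SkewSeries τ} (h : u * v = 0) : u = 0 ∨ v = 0 := by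
  by_contra! h'
  obtain ⟨w₁, h₁, hu⟩ := exists_shortest h'.1
  obtain ⟨w₂, h₂, hv⟩ := exists_shortest h'.2
  have key := mul_apply_append w₁ w₂ hu hv
  rw [h, zero_apply, eq_comm, mul_eq_zero] at key
  refine key.elim (fun h0 => h₁ ?_) h₂
  exact twist_injective hτ w₂ (h0.trans (map_zero _).symm)

end SkewSeries

end

/-! ### Geometric series, supports and colour blocks -/

noncomputable section

namespace SkewSeries

variable {S R : Type*} [CommRing R] {τ : S → R →+* R}

open scoped Classical in
variable (τ) in
/-- The sum of all words in the letters of the set `A`. -/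
def geom (A : Set S) : SkewSeries τ := fun w => if ∀ s ∈ w, s ∈ A then 1 else 0

open scoped Classical in
variable (τ) in
/-- The series `1 - ∑ x s`, where `s` runs over the set `A`. -/
def geomInv (A : Set S) : SkewSeries τ
  | [] => 1
  | [s] => if s ∈ A then -1 else 0
  | _ :: _ :: _ => 0

@[simp] theorem geom_nil (A : Set S) : geom τ A [] = 1 := by simp [geom]

@[simp] theorem geomInv_nil (A : Set S) : geomInv τ A [] = 1 := rfl

open scoped Classical in
@[simp] theorem geomInv_singleton (A : Set S) (s : S) :
    geomInv τ A [s] = if s ∈ A then -1 else 0 := rfl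

@[simp] theorem geomInv_cons_cons (A : Set S) (s t : S) (w : List S) :
    geomInv τ A (s :: t :: w) = 0 := rfl

open scoped Classical in
theorem deriv_geom (A : Set S) (s : S) :
    deriv s (geom τ A) = if s ∈ A then geom τ A else 0 := by
  ext w
  by_cases h : s ∈ A <;> simp [geom, h]

open scoped Classical in
theorem deriv_geomInv (A : Set S) (s : S) :
    deriv s (geomInv τ A) = const τ (if s ∈ A then -1 else 0) := by
  ext w
  cases w <;> simp

/-- The identity is checked word by word, so `A` may be infinite. -/
theorem geom_mul_geomInv (A : Set S) : geom τ A * geomInv τ A = 1 := by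
  ext w
  induction w with
  | nil => simp [mul_nil, one_def]
  | cons s w ih =>
    rw [mul_cons, deriv_geom]
    by_cases h : s ∈ A
    · rw [if_pos h, ih]
      cases w <;> simp [one_def, h]
    · rw [if_neg h]
      cases w <;> simp [one_def, h]

open scoped Classical in
theorem geomInv_mul_geom (A : Set S) : geomInv τ A * geom τ A = 1 := by
  ext w
  cases w with
  | nil => simp [mul_nil, one_def]
  | cons s w =>
    have key : geom τ A (s :: w) = if s ∈ A then geom τ A w else 0 := by
      rw [← deriv_apply s (geom τ A) w, deriv_geom]
      split_ifs <;> rfl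
    rw [mul_cons, deriv_geomInv, const_mul_apply, key]
    by_cases h : s ∈ A <;> simp [h, one_def]

/-- All words with nonzero coefficients in `u` consist of letters of the set `A`. -/
def SupportedOn (A : Set S) (u : SkewSeries τ) : Prop := ∀ w : List S, (∃ s ∈ w, s ∉ A) → u w = 0

theorem SupportedOn.deriv {A : Set S} {u : SkewSeries τ} (hu : SupportedOn A u) (s : S) :
    SupportedOn A (deriv s u) := fun w ⟨t, ht, hA⟩ => hu (s :: w) ⟨t, by simp [ht], hA⟩

theorem SupportedOn.deriv_eq_zero {A : Set S} {u : SkewSeries τ} (hu : SupportedOn A u) {s : S}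
    (hs : s ∉ A) : SkewSeries.deriv s u = 0 := by
  ext w
  exact hu (s :: w) ⟨s, by simp, hs⟩

theorem SupportedOn.mul {A : Set S} {u v : SkewSeries τ} (hu : SupportedOn A u)
    (hv : SupportedOn A v) : SupportedOn A (u * v) := by
  intro w hw
  induction w generalizing u with
  | nil => simp at hw
  | cons s w ih =>
    rw [mul_cons, hv _ hw, mul_zero, zero_add]
    by_cases hs : s ∈ A
    · refine ih (hu.deriv s) ?_
      obtain ⟨t, ht, hA⟩ := hw
      rcases List.mem_cons.1 ht with rfl | ht
      · exact absurd hs hA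
      · exact ⟨t, ht, hA⟩
    · rw [hu.deriv_eq_zero hs, zero_mul, zero_apply]

theorem supportedOn_const (A : Set S) (a : R) : SupportedOn A (const τ a) := by
  rintro (_ | ⟨s, w⟩) hw
  · simp at hw
  · rfl

theorem supportedOn_geom {A A' : Set S} (h : A ⊆ A') : SupportedOn A' (geom τ A) := by
  rintro w ⟨s, hs, hA⟩
  rw [geom, if_neg fun H => hA (h (H s hs))]

theorem supportedOn_geomInv {A A' : Set S} (h : A ⊆ A') : SupportedOn A' (geomInv τ A) := by
  rintro (_ | ⟨s, _ | ⟨t, w⟩⟩) hw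
  · simp at hw
  · obtain ⟨t, ht, hA⟩ := hw
    rw [List.mem_singleton] at ht
    subst ht
    simp [show t ∉ A from fun H => hA (h H)]
  · rfl

theorem mul_apply_of_head_ne {Q : Type*} {e : S → Q} {q : Q} {u v : SkewSeries τ}
    (hu : SupportedOn {s | e s = q} u) (w : List S)
    (hw : ∀ s ∈ w.head?, e s ≠ q) : (u * v) w = twist τ w (u []) * v w := by
  cases w with
  | nil => rfl
  | cons s w => rw [mul_cons, hu.deriv_eq_zero (hw s (by simp)), zero_mul, zero_apply, add_zero]

section Blocks

variable {Q : Type*} [DecidableEq Q]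

/-- The number of maximal blocks of consecutive letters of the same colour in a word. -/
def blocks (e : S → Q) : List S → ℕ
  | [] => 0
  | [_] => 1
  | s :: t :: w => if e s = e t then blocks e (t :: w) else blocks e (t :: w) + 1

theorem blocks_le_cons (e : S → Q) (s : S) (w : List S) : blocks e w ≤ blocks e (s :: w) := by
  cases w with
  | nil => simp [blocks]
  | cons t w => rw [blocks]; split_ifs <;> omega

theorem blocks_cons_of_eq (e : S → Q) (s t : S) (w : List S) (h : e s = e t) :
    blocks e (s :: t :: w) = blocks e (t :: w) := by rw [blocks, if_pos h]

theorem blocks_cons_of_head_ne (e : S → Q) (s : S) (w : List S) (h : ∀ t ∈ w.head?, e t ≠ e s) :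
    blocks e (s :: w) = blocks e w + 1 := by
  cases w with
  | nil => rfl
  | cons t w => rw [blocks, if_neg fun H => h t (by simp) H.symm]

theorem blocks_dropWhile_le (e : S → Q) (q : Q) (w : List S) :
    blocks e (w.dropWhile (e · = q)) ≤ blocks e w := by
  induction w with
  | nil => simp
  | cons s w ih =>
    rw [List.dropWhile_cons]
    split_ifs
    · exact ih.trans (blocks_le_cons e s w)
    · exact le_rfl

theorem blocks_le_dropWhile (e : S → Q) (q : Q) (w : List S) :
    blocks e w ≤ blocks e (w.dropWhile (e · = q)) + 1 := by
  induction w with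
  | nil => simp [blocks]
  | cons s w ih =>
    rw [List.dropWhile_cons]
    split_ifs with h
    · cases w with
      | nil => simp [blocks]
      | cons t w =>
        rw [decide_eq_true_eq] at h
        rw [blocks]
        split_ifs with h'
        · exact ih
        · rw [List.dropWhile_cons, if_neg (by simpa [← h] using Ne.symm h')]
    · omega

variable {e : S → Q} {q : Q} {u v : SkewSeries τ} {n : ℕ}

/-- The factor `u` can absorb only initial letters of colour `q`; what is left for `v` still has too
many blocks. -/
theorem mul_apply_eq_zero_of_lt_blocks (hu : SupportedOn {s | e s = q} u)
    (hv : ∀ w : List S, n < blocks e w → v w = 0) (w : List S)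
    (hw : n < blocks e (w.dropWhile (e · = q))) : (u * v) w = 0 := by
  induction w generalizing u with
  | nil => simp [blocks] at hw
  | cons s w ih =>
    rw [mul_cons, hv _ (hw.trans_le (blocks_dropWhile_le e q _)), mul_zero, zero_add]
    by_cases hs : e s = q
    · rw [List.dropWhile_cons, if_pos (by simpa using hs)] at hw
      exact ih (hu.deriv s) hw
    · rw [hu.deriv_eq_zero hs, zero_mul, zero_apply]

/-- Of the two letters of colour `q`, `u` must take both, since otherwise `v` is evaluated at a word
with `n + 1` blocks; it cannot take more, because the next letter has another colour. -/
theorem mul_apply_cons_cons (hu : SupportedOn {s | e s = q} u)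
    (hv : ∀ w : List S, n < blocks e w → v w = 0) (s t : S) (w : List S) (hs : e s = q)
    (ht : e t = q) (hw : ∀ s ∈ w.head?, e s ≠ q) (hn : blocks e w = n) :
    (u * v) (s :: t :: w) = twist τ w (u [s, t]) * v w := by
  have h1 : blocks e (t :: w) = n + 1 := by rw [blocks_cons_of_head_ne _ _ _ (ht ▸ hw), hn]
  rw [mul_cons, mul_cons, hv _ (by rw [blocks_cons_of_eq _ _ _ _ (hs.trans ht.symm)]; omega),
    hv (t :: w) (by omega), mul_apply_of_head_ne ((hu.deriv s).deriv t) w hw]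
  simp

end Blocks

-- The only two-letter coefficient that is needed. The second letter comes either from the left
-- series, leaving `a` unchanged, or from the right one, where `a` is moved past it and becomes `τ t
-- a`.
open scoped Classical in
theorem geom_mul_const_mul_geomInv_pair (A A' : Set S) (a : R) (s t : S) (hs : s ∈ A) :
    (geom τ A * const τ a * geomInv τ A') [s, t] =
      (if t ∈ A then a else 0) - if t ∈ A' then τ t a else 0 := by
  rw [mul_assoc, mul_cons (geom τ A), deriv_geom, if_pos hs, mul_cons (geom τ A), deriv_geom,
    const_mul_apply, const_mul_apply]
  by_cases h : t ∈ A <;> by_cases h' : t ∈ A' <;> simp [h, h', mul_nil]; ring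

end SkewSeries

end

/-! ### Decomposition of paths into runs -/

noncomputable section

section Runs

variable {V : Type*}

/-- The list `[j, i, j, ...]` of length `n`. -/
def alternating : V → V → ℕ → List V
  | _, _, 0 => []
  | i, j, n + 1 => j :: alternating j i n

theorem alternating_prefix (i j : V) {m n : ℕ} (h : m ≤ n) :
    alternating i j m <+: alternating i j n := by
  induction n generalizing i j m with
  | zero =>
    obtain rfl : m = 0 := by omega
    exact List.prefix_rfl
  | succ n ih =>
    cases m with
    | zero => exact List.nil_prefix
    | succ m => exact (List.cons_prefix_cons).2 ⟨rfl, ih j i (by omega)⟩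

/-- The last edge of the alternating path `i, j, i, ...` with `n` edges, run through backwards. -/
def lastDart (i j : V) (n : ℕ) : V × V := if Even n then (i, j) else (j, i)

@[simp] theorem lastDart_zero (i j : V) : lastDart i j 0 = (i, j) := by simp [lastDart]

@[simp] theorem lastDart_succ (i j : V) (n : ℕ) : lastDart i j (n + 1) = lastDart j i n := by
  by_cases h : Even n <;> simp [lastDart, Nat.even_add_one, h]

theorem mk_lastDart (i j : V) (n : ℕ) : s((lastDart i j n).1, (lastDart i j n).2) = s(i, j) := by
  unfold lastDart
  split_ifs
  · rfl
  · exact Sym2.eq_swap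

/-- A path is given by its initial vertex and the list of its other vertices. It decomposes into
runs, in each of which it keeps running back and forth along an edge. This is the length of the
first run. -/
def runLength [DecidableEq V] : V → List V → ℕ
  | _, [] => 0
  | _, [_] => 1
  | i, j :: k :: l => if k = i then runLength j (k :: l) + 1 else 1

/-- The number of runs of a path. -/
def runCount [DecidableEq V] : V → List V → ℕ
  | _, [] => 0
  | _, [_] => 1
  | i, j :: k :: l => if k = i then runCount j (k :: l) else runCount j (k :: l) + 1

/-- A path along edges of a graph which does not run back and forth `d i j` times along any edge. -/
structure IsReducedPath (G : SimpleGraph V) (d : V → V → ℕ∞) (i : V) (l : List V) : Prop where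
  isChain : (i :: l).IsChain G.Adj
  not_infix : ∀ u v, ∀ n : ℕ, d u v = n → ¬ (u :: alternating u v (2 * n)) <:+: (i :: l)

variable {G : SimpleGraph V} {d : V → V → ℕ∞}

theorem IsReducedPath.of_suffix {i p : V} {l l' : List V} (h : IsReducedPath G d i l)
    (hs : p :: l' <:+ i :: l) : IsReducedPath G d p l' :=
  ⟨h.isChain.suffix hs, fun u v n hn hi => h.not_infix u v n hn (hi.trans hs.isInfix)⟩

theorem cons_drop_suffix (i j : V) (l : List V) (n : ℕ) (l' : List V)
    (h : alternating i j n ++ l' = l) : (lastDart i j n).1 :: l' <:+ i :: l := by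
  induction n generalizing i j l with
  | zero => subst h; simp [alternating]
  | succ n ih =>
    subst h
    rw [lastDart_succ]
    exact (ih j i _ rfl).trans (List.suffix_cons _ _)

theorem IsReducedPath.adj {i j : V} {l : List V} (h : IsReducedPath G d i (j :: l)) : G.Adj i j :=
  (List.isChain_cons_cons.1 h.isChain).1

variable [DecidableEq V]

theorem runLength_pos (i j : V) (l : List V) : 0 < runLength i (j :: l) := by
  cases l with
  | nil => simp [runLength]
  | cons k l => rw [runLength]; split_ifs <;> omega

theorem alternating_append_drop (i j : V) (l : List V) :
    alternating i j (runLength i (j :: l)) ++ (j :: l).drop (runLength i (j :: l)) = j :: l := by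
  induction l generalizing i j with
  | nil => simp [runLength, alternating]
  | cons k l ih =>
    rw [runLength]
    split_ifs with h
    · subst h
      simp [alternating, ih]
    · simp [alternating]

theorem runCount_cons (i j : V) (l : List V) :
    runCount i (j :: l) = runCount (lastDart i j (runLength i (j :: l))).1
      ((j :: l).drop (runLength i (j :: l))) + 1 := by
  induction l generalizing i j with
  | nil => simp [runLength, runCount]
  | cons k l ih =>
    rw [runLength, runCount]
    split_ifs with h
    · subst h
      simp [ih]
    · simp [lastDart]

/-- Runs are maximal, so two consecutive runs use different edges. -/
theorem head_drop_ne (i j : V) (l : List V) :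
    ∀ k ∈ ((j :: l).drop (runLength i (j :: l))).head?,
      k ≠ (lastDart i j (runLength i (j :: l))).2 := by
  induction l generalizing i j with
  | nil => simp [runLength]
  | cons k l ih =>
    rw [runLength]
    split_ifs with h
    · subst h
      simpa using ih j k
    · simpa [lastDart] using h

theorem eq_nil_of_runCount_eq_zero {i : V} {l : List V} (h : runCount i l = 0) : l = [] := by
  cases l with
  | nil => rfl
  | cons j l => rw [runCount_cons] at h; omega

theorem IsReducedPath.drop_runLength {i j : V} {l : List V} (h : IsReducedPath G d i (j :: l)) :
    IsReducedPath G d (lastDart i j (runLength i (j :: l))).1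
      ((j :: l).drop (runLength i (j :: l))) :=
  h.of_suffix (cons_drop_suffix i j _ _ _ (alternating_append_drop i j l))

/-- This bound keeps the degree in the Vandermonde argument below the number of available points. -/
theorem IsReducedPath.runLength_lt {i j : V} {l : List V} (h : IsReducedPath G d i (j :: l))
    {n : ℕ} (hn : d i j = n) : runLength i (j :: l) < 2 * n := by
  by_contra! hlt
  refine h.not_infix i j n hn (List.IsPrefix.isInfix ?_)
  rw [← alternating_append_drop i j l, List.cons_prefix_cons]
  exact ⟨rfl, (alternating_prefix i j hlt).trans (List.prefix_append _ _)⟩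

end Runs

-- Lengths of the same parity as `n` are turned into exponents of `z t ^ 2` by halving, so the
-- hypothesis gives the values of a polynomial of degree less than `F.card` at `F.card` distinct
-- points. The parity has to be fixed beforehand because only the squares are known to be distinct.
-- The constant `K` makes room for the terms not depending on `t`.
open Polynomial in
theorem sum_filter_eq_zero_of_sum_pow_eq {ι T R : Type*} [CommRing R] [IsDomain R] (L : Finset ι)
    (len : ι → ℕ) (m : ι → R) (F : Finset T) (z : T → R)
    (hz : Set.InjOn (fun t => z t ^ 2) F) (hz0 : ∀ t ∈ F, z t ≠ 0)
    (hlen : ∀ l ∈ L, len l < 2 * F.card)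
    (n : ℕ) (hn : 0 < n) (K : R) (hK : ¬ Even n → K = 0)
    (h : ∀ t ∈ F, ∑ l ∈ L with (Even (len l) ↔ Even n), z t ^ len l * m l = K) :
    ∑ l ∈ L with len l = n, m l = 0 := by
  classical
  rcases Finset.eq_empty_or_nonempty F with rfl | hF
  · rw [Finset.filter_false_of_mem, Finset.sum_empty]
    intro l hl
    exact absurd (hlen l hl) (by simp)
  have hcard : 0 < F.card := hF.card_pos
  set P : R[X] := ∑ l ∈ L with (Even (len l) ↔ Even n), C (m l) * X ^ (len l / 2) with hP
  have hodd : ∀ l, (Even (len l) ↔ Even n) → len l = 2 * (len l / 2) + n % 2 := by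
    intro l hl
    rw [Nat.even_iff, Nat.even_iff] at hl
    omega
  have hPeval : ∀ t ∈ F, z t ^ (n % 2) * P.eval (z t ^ 2) = K := by
    intro t ht
    rw [← h t ht, hP, eval_finsetSum, Finset.mul_sum]
    refine Finset.sum_congr rfl fun l hl => ?_
    have := hodd l (Finset.mem_filter.1 hl).2
    conv_rhs => rw [this]
    simp only [eval_mul, eval_C, eval_pow, eval_X]
    ring
  -- For odd `n` the constant `K` is zero and the remaining factor `z t` is cancelled.
  have hQ : P - C K = 0 := by
    refine eq_zero_of_natDegree_lt_card_of_eval_eq_zero' _ (F.image fun t => z t ^ 2) ?_ ?_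
    · intro x hx
      obtain ⟨t, ht, rfl⟩ := Finset.mem_image.1 hx
      have := hPeval t ht
      rw [eval_sub, eval_C]
      by_cases hev : Even n
      · rw [Nat.even_iff.1 hev, pow_zero, one_mul] at this
        rw [this, sub_self]
      · rw [hK hev, mul_eq_zero] at this
        rw [hK hev, sub_zero]
        exact this.resolve_left (pow_ne_zero _ (hz0 t ht))
    · rw [Finset.card_image_of_injOn hz]
      refine (natDegree_sub_le _ _).trans_lt ?_
      rw [natDegree_C, max_lt_iff]
      refine ⟨?_, hcard⟩
      refine (natDegree_sum_le _ _).trans_lt ?_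
      rw [Finset.fold_max_lt]
      refine ⟨hcard, fun l hl => ?_⟩
      refine (natDegree_C_mul_X_pow_le _ _).trans_lt ?_
      have := hlen l (Finset.mem_filter.1 hl).1
      omega
  -- For even `n` the index `n / 2` is positive, so `K` does not affect this coefficient; for odd
  -- `n` it vanishes anyway.
  have hcoeff := congrArg (fun p => p.coeff (n / 2)) (sub_eq_zero.1 hQ)
  simp only [hP, finsetSum_coeff, coeff_C_mul, coeff_X_pow, mul_ite, mul_one, mul_zero,
    coeff_C] at hcoeff
  rw [← Finset.sum_filter, Finset.filter_filter] at hcoeff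
  have hfilter : ∀ l, ((Even (len l) ↔ Even n) ∧ n / 2 = len l / 2) ↔ len l = n := by
    intro l
    rw [Nat.even_iff, Nat.even_iff]
    constructor
    · omega
    · rintro h; rw [h]; simp
  simp only [hfilter] at hcoeff
  rw [hcoeff]
  split_ifs with h0
  · exact hK (by rw [Nat.even_iff]; omega)
  · rfl
end

/-! ### Series of paths and their linear independence -/

noncomputable section

namespace SkewSeries

variable {V T R : Type*} [CommRing R] (τ : T → R →+* R) (b : V → V → R)

/-- The twisting of coefficients for variables indexed by an oriented edge and an element of `T`. -/
def dartTwist : (V × V) × T → R →+* R := fun s => τ s.2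

/-- The series attached to an edge: a conjugate, by series in the variables of this edge and of its
reverse, of the coefficient `b i j`. -/
def edgeSeries (i j : V) : SkewSeries (dartTwist (V := V) τ) :=
  geom _ {s | s.1 = (i, j)} * const _ (b i j) * geomInv _ {s | s.1 = (j, i)}

/-- The product of the series attached to the edges of a path. -/
def pathSeries : V → List V → SkewSeries (dartTwist (V := V) τ)
  | _, [] => 1
  | i, j :: l => edgeSeries τ b i j * pathSeries j l

variable {τ b}

theorem pathSeries_append (i : V) (l l' : List V) :
    pathSeries τ b i (l ++ l') =
      pathSeries τ b i l * pathSeries τ b ((i :: l).getLast (by simp)) l' := by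
  induction l generalizing i with
  | nil => simp [pathSeries]
  | cons j l ih => simp [pathSeries, ih, mul_assoc]

/-- Consecutive edges of the run are mutually reverse, so the inverse series ending one factor
cancels the geometric series starting the next. -/
theorem pathSeries_alternating_append (hb : ∀ i j, b i j = b j i) (i j : V) (n : ℕ) (l : List V) :
    pathSeries τ b i (alternating i j n ++ l) =
      geom _ {s | s.1 = (i, j)} * const _ (b i j ^ n) * geomInv _ {s | s.1 = lastDart i j n} *
        pathSeries τ b (lastDart i j n).1 l := by
  induction n generalizing i j with
  | zero =>
    have : const (dartTwist (V := V) τ) (b i j ^ 0) = 1 := by rw [pow_zero]; rfl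
    rw [this, mul_one, lastDart_zero, geom_mul_geomInv, one_mul]
    rfl
  | succ n ih =>
    rw [alternating, List.cons_append, pathSeries, ih, lastDart_succ, edgeSeries, pow_succ',
      ← const_mul_const, hb j i]
    simp only [mul_assoc]
    rw [← mul_assoc (geomInv _ _) (geom _ _), geomInv_mul_geom, one_mul]

/-- The colour of a variable is the underlying unoriented edge. -/
def colour (s : (V × V) × T) : Sym2 V := s(s.1.1, s.1.2)

theorem supportedOn_run (i j : V) (n : ℕ) (a : R) :
    SupportedOn {s | colour s = s(i, j)} (geom (dartTwist τ) {s : (V × V) × T | s.1 = (i, j)} *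
      const _ a * geomInv _ {s | s.1 = lastDart i j n}) := by
  refine ((supportedOn_geom ?_).mul (supportedOn_const _ _)).mul (supportedOn_geomInv ?_)
  · rintro s (hs : s.1 = (i, j))
    simp [colour, hs]
  · rintro s (hs : s.1 = lastDart i j n)
    simp only [Set.mem_ofPred_eq, colour, hs, mk_lastDart]

variable [DecidableEq V]

theorem pathSeries_cons (hb : ∀ i j, b i j = b j i) (i j : V) (l : List V) :
    pathSeries τ b i (j :: l) =
      geom _ {s | s.1 = (i, j)} * const _ (b i j ^ runLength i (j :: l)) *
        geomInv _ {s | s.1 = lastDart i j (runLength i (j :: l))} *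
        pathSeries τ b (lastDart i j (runLength i (j :: l))).1
          ((j :: l).drop (runLength i (j :: l))) := by
  rw [← pathSeries_alternating_append hb, alternating_append_drop]

/-- Each run has a single colour and so accounts for at most one block of a word. -/
theorem pathSeries_apply_eq_zero (hb : ∀ i j, b i j = b j i) (n : ℕ) (i : V) (l : List V)
    (hl : runCount i l ≤ n) (w : List ((V × V) × T)) (hw : n < blocks colour w) :
    pathSeries τ b i l w = 0 := by
  induction n generalizing i l w with
  | zero =>
    obtain rfl := eq_nil_of_runCount_eq_zero (Nat.le_zero.1 hl)
    cases w with
    | nil => simp [blocks] at hw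
    | cons s w => rfl
  | succ n ih =>
    cases l with
    | nil =>
      cases w with
      | nil => simp [blocks] at hw
      | cons s w => rfl
    | cons j l =>
      rw [pathSeries_cons hb]
      refine mul_apply_eq_zero_of_lt_blocks (n := n) (supportedOn_run i j _ _)
        (fun w' hw' => ?_) w ?_
      · refine ih _ _ ?_ _ hw'
        rw [runCount_cons] at hl
        omega
      · have := blocks_le_dropWhile colour s(i, j) w
        omega

variable [IsDomain R] {G : SimpleGraph V} {d : V → V → ℕ∞}

/-- Induction on the maximal number of runs, peeling off the first run. The set `q` records the
colour of the run peeled off before: words starting with that colour cannot be tested, since their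
block would merge with the preceding one. Paths with fewer runs may occur in `L`, but nothing is
claimed about their coefficients. -/
theorem eq_zero_of_sum_pathSeries_apply_eq_zero (hτ : ∀ t, Function.Injective (τ t))
    (hb : ∀ i j, b i j = b j i) (hb0 : ∀ i j, G.Adj i j → b i j ≠ 0)
    (sep : ∀ i j, G.Adj i j → ∀ n : ℕ, (n : ℕ∞) ≤ d i j →
      ∃ F : Finset T, F.card = n ∧ Set.InjOn (fun t => τ t (b i j) ^ 2) F)
    (n : ℕ) (q : Set (Sym2 V)) (i : V) (L : Finset (List V)) (a : List V → R)
    (hL : ∀ l ∈ L, IsReducedPath G d i l ∧ runCount i l ≤ n)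
    (h : ∀ w : List ((V × V) × T), blocks colour w = n → (∀ s ∈ w.head?, colour s ∉ q) →
      ∑ l ∈ L, pathSeries τ b i l w * a l = 0)
    (l : List V) (hl : l ∈ L) (hln : runCount i l = n) (hlq : ∀ j ∈ l.head?, s(i, j) ∉ q) :
    a l = 0 := by
  induction n generalizing q i L a l with
  | zero =>
    have hnil : ∀ l ∈ L, l = [] := fun l hl =>
      eq_nil_of_runCount_eq_zero (Nat.le_zero.1 (hL l hl).2)
    obtain rfl := hnil l hl
    have hL1 : L = {[]} := Finset.eq_singleton_iff_unique_mem.2 ⟨hl, hnil⟩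
    have := h [] (by simp [blocks]) (by simp)
    rw [hL1, Finset.sum_singleton] at this
    simpa [pathSeries, one_def] using this
  | succ n ih =>
    obtain _ | ⟨j, l₀⟩ := l
    · simp [runCount] at hln
    have hadj : G.Adj i j := (hL _ hl).1.adj
    set m := runLength i (j :: l₀) with hm
    set e := lastDart i j m with he
    set L₁ := L.filter (fun l => l.head? = some j) with hL₁
    set L₂ := L₁.filter (fun l => runLength i l = m) with hL₂
    have hmem₁ : ∀ l ∈ L₁, ∃ l', l = j :: l' ∧ j :: l' ∈ L := by
      intro l hl
      obtain ⟨h1, h2⟩ := Finset.mem_filter.1 hl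
      cases l with
      | nil => simp at h2
      | cons k l =>
        obtain rfl : k = j := by simpa using h2
        exact ⟨l, rfl, h1⟩
    have hmem₂ : ∀ l ∈ L₂, ∃ l', l = j :: l' ∧ j :: l' ∈ L ∧ runLength i (j :: l') = m := by
      intro l hl
      obtain ⟨h1, h2⟩ := Finset.mem_filter.1 hl
      obtain ⟨l', rfl, h'⟩ := hmem₁ l h1
      exact ⟨l', rfl, h', h2⟩
    have hrec : ∀ l ∈ L₂, alternating i j m ++ l.drop m = l := by
      intro l hl
      obtain ⟨l', rfl, -, h'⟩ := hmem₂ l hl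
      rw [← h', alternating_append_drop]
    -- Among all paths in `L`, this isolates those whose first run agrees with that of the given
    -- path.
    have key : ∀ w : List ((V × V) × T), blocks colour w = n →
        (∀ s ∈ w.head?, colour s ∉ ({s(i, j)} : Set (Sym2 V))) →
        ∑ l ∈ L₂, pathSeries τ b e.1 (l.drop m) w * a l = 0 := by
      intro w hw hhead
      have hcol : ∀ t : T, colour ((i, j), t) = s(i, j) := fun t => rfl
      have hcol' : ∀ t : T, colour (e, t) = s(i, j) := fun t => mk_lastDart i j m
      -- A path leaving `i` along another edge cannot absorb the first block in its first run, and
      -- its other runs are too few for `n + 1` blocks.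
      have hzero : ∀ t : T, ∀ l ∈ L, l ∉ L₁ →
          pathSeries τ b i l (((i, j), t) :: (e, t) :: w) = 0 := by
        intro t l hl' hl1
        cases l with
        | nil => rfl
        | cons k l =>
          have hk : k ≠ j := by
            rintro rfl
            exact hl1 (Finset.mem_filter.2 ⟨hl', rfl⟩)
          rw [pathSeries_cons hb]
          refine mul_apply_eq_zero_of_lt_blocks (n := n) (supportedOn_run i k _ _)
            (fun w' hw' => ?_) _ ?_
          · refine pathSeries_apply_eq_zero hb n _ _ ?_ _ hw'
            have := (hL _ hl').2
            rw [runCount_cons] at this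
            omega
          · rw [List.dropWhile_cons, if_neg, blocks_cons_of_eq _ _ _ _ ((hcol t).trans (hcol' t).symm),
              blocks_cons_of_head_ne, hw]
            · omega
            · intro s hs
              rw [hcol']
              exact hhead s hs
            · rw [decide_eq_true_eq, hcol, Sym2.congr_right]
              exact hk.symm
      -- The second letter lies on the dart `e`, whose orientation depends on the parity of `m`.
      -- Hence the term twisted by `t` appears exactly for runs with the parity of `m`, while the
      -- other term does not depend on `t`.
      have hmain : ∀ t : T, ∀ l ∈ L₁, pathSeries τ b i l (((i, j), t) :: (e, t) :: w) =
          ((if Even m then twist (dartTwist τ) w (b i j ^ runLength i l) else 0) -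
            if (Even (runLength i l) ↔ Even m) then
              twist (dartTwist τ) w (τ t (b i j)) ^ runLength i l else 0) *
            pathSeries τ b (lastDart i j (runLength i l)).1 (l.drop (runLength i l)) w := by
        intro t l hl
        obtain ⟨l, rfl, h'⟩ := hmem₁ l hl
        have hcount := (hL _ h').2
        rw [runCount_cons] at hcount
        rw [pathSeries_cons hb, mul_apply_cons_cons (n := n) (supportedOn_run i j _ _)
          (fun w' hw' => pathSeries_apply_eq_zero hb n _ _ (by omega) _ hw') _ _ _ (hcol t)
          (hcol' t) hhead hw, geom_mul_const_mul_geomInv_pair _ _ _ _ _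
            (show ((i, j), t) ∈ {s : (V × V) × T | s.1 = (i, j)} from rfl)]
        have h1 : ((e, t) ∈ {s : (V × V) × T | s.1 = (i, j)}) ↔ Even m := by
          have := hadj.ne
          simp only [he, lastDart, Set.mem_ofPred_eq]
          split_ifs with hm' <;> simp [hm', this.symm]
        have h2 : ((e, t) ∈ {s : (V × V) × T | s.1 = lastDart i j (runLength i (j :: l))}) ↔
            (Even (runLength i (j :: l)) ↔ Even m) := by
          have := hadj.ne
          simp only [he, lastDart, Set.mem_ofPred_eq]
          split_ifs with hm' hm'' hm'' <;> simp [hm', hm'', this, this.symm]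
        simp only [h1, h2]
        rw [map_sub]
        congr 2
        · split_ifs <;> simp
        · split_ifs <;> simp [dartTwist]
      have hbound : ∃ N : ℕ, (N : ℕ∞) ≤ d i j ∧ ∀ l ∈ L₁, runLength i l < 2 * N := by
        cases hd : d i j with
        | top =>
          -- With no bound on the number of points, `N` is chosen to exceed all run lengths in the
          -- finite set.
          refine ⟨L₁.sup (runLength i) + 1, le_top, fun l hl => ?_⟩
          have := Finset.le_sup (f := runLength i) hl
          omega
        | coe N =>
          refine ⟨N, le_rfl, fun l hl => ?_⟩
          obtain ⟨l, rfl, h'⟩ := hmem₁ l hl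
          exact (hL _ h').1.runLength_lt hd
      obtain ⟨N, hN, hlt⟩ := hbound
      obtain ⟨F, rfl, hF⟩ := sep i j hadj N hN
      have hinj := twist_injective (τ := dartTwist (V := V) τ) (fun s => hτ s.2) w
      have := sum_filter_eq_zero_of_sum_pow_eq L₁ (runLength i)
        (fun l => pathSeries τ b (lastDart i j (runLength i l)).1 (l.drop (runLength i l)) w * a l) F
        (fun t => twist (dartTwist τ) w (τ t (b i j))) ?_ ?_ hlt m (runLength_pos i j l₀)
        (∑ l ∈ L₁, (if Even m then twist (dartTwist τ) w (b i j ^ runLength i l) else 0) *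
          pathSeries τ b (lastDart i j (runLength i l)).1 (l.drop (runLength i l)) w * a l) ?_ ?_
      · rw [← this]
        refine Finset.sum_congr rfl fun l hl => ?_
        rw [(Finset.mem_filter.1 hl).2]
      · intro t ht t' ht' htt'
        simp only [← map_pow] at htt'
        exact hF ht ht' (by simpa using hinj htt')
      · intro t _ h0
        rw [map_eq_zero_iff _ hinj, map_eq_zero_iff _ (hτ t)] at h0
        exact hb0 i j hadj h0
      · intro hodd
        simp [hodd]
      · intro t _
        have hsum := h (((i, j), t) :: (e, t) :: w) ?_ ?_
        · rw [← Finset.sum_subset (Finset.filter_subset _ L : L₁ ⊆ L) fun l hl hl' => by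
            rw [hzero t l hl hl', zero_mul]] at hsum
          rw [Finset.sum_congr rfl fun l hl => by rw [hmain t l hl, sub_mul, sub_mul],
            Finset.sum_sub_distrib, sub_eq_zero] at hsum
          rw [hsum, Finset.sum_filter]
          refine Finset.sum_congr rfl fun l _ => ?_
          split_ifs <;> ring
        · rw [blocks_cons_of_eq _ _ _ _ ((hcol t).trans (hcol' t).symm), blocks_cons_of_head_ne, hw]
          intro s hs
          rw [hcol']
          exact hhead s hs
        · intro s hs
          obtain rfl : ((i, j), t) = s := by simpa using hs
          exact hlq j (by simp)
    -- All paths in `L₂` start with the same run, so dropping it is injective and the coefficients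
    -- carry over to the remainders.
    have := ih {s(i, j)} e.1 (L₂.image (List.drop m)) (fun l => a (alternating i j m ++ l)) ?_ ?_
      ((j :: l₀).drop m) ?_ ?_ ?_
    · rwa [alternating_append_drop] at this
    · intro l hl
      obtain ⟨l₁, hl₁, rfl⟩ := Finset.mem_image.1 hl
      obtain ⟨l', rfl, h', h''⟩ := hmem₂ l₁ hl₁
      obtain ⟨h1, h2⟩ := hL _ h'
      rw [he, ← h'']
      rw [runCount_cons] at h2
      exact ⟨h1.drop_runLength, by omega⟩
    · intro w hw hhead
      rw [Finset.sum_image]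
      · rw [← key w hw hhead]
        refine Finset.sum_congr rfl fun l hl => ?_
        rw [hrec l hl]
      · intro l hl l' hl' hll'
        rw [← hrec l hl, ← hrec l' hl', hll']
    · exact Finset.mem_image_of_mem _ (Finset.mem_filter.2 ⟨Finset.mem_filter.2 ⟨hl, rfl⟩, rfl⟩)
    · rw [runCount_cons] at hln
      exact Nat.succ_injective hln
    · intro k hk
      have hne := head_drop_ne i j l₀ k hk
      rw [Set.mem_singleton_iff, ← mk_lastDart i j m, Sym2.congr_right]
      exact hne

end SkewSeries

end

/-! ### The polynomial of `4 cos² (π / m)` and separating endomorphisms -/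

noncomputable section

open Polynomial

theorem isIntegral_four_mul_cos_sq (m : ℕ) : IsIntegral ℤ (4 * Real.cos (Real.pi / m) ^ 2) := by
  have h := (Real.isIntegral_two_mul_cos_rat_mul_pi (1 / m)).pow 2
  convert h using 1
  push_cast
  ring_nf

theorem cosPoly_monic (m : ℕ) : (cosPoly m).Monic := minpoly.monic (isIntegral_four_mul_cos_sq m)

theorem map_cosPoly (m : ℕ) : (cosPoly m).map (algebraMap ℤ ℚ) =
    minpoly ℚ (4 * Real.cos (Real.pi / m) ^ 2) :=
  (minpoly.isIntegrallyClosed_eq_field_fractions' ℚ (isIntegral_four_mul_cos_sq m)).symm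

theorem irreducible_map_cosPoly (m : ℕ) : Irreducible ((cosPoly m).map (algebraMap ℤ ℚ)) := by
  rw [map_cosPoly]
  exact minpoly.irreducible (isIntegral_four_mul_cos_sq m).tower_top

/-- Otherwise the irreducible polynomial would be `X` and `4 cos² (π / m)` would vanish, but `0 < π
/ m < π / 2`. -/
theorem not_X_dvd_map_cosPoly {m : ℕ} (hm : 3 ≤ m) : ¬ X ∣ (cosPoly m).map (algebraMap ℤ ℚ) := by
  intro h
  have hassoc := Polynomial.irreducible_X.associated_of_dvd (irreducible_map_cosPoly m) h
  have heq := eq_of_monic_of_associated monic_X ((cosPoly_monic m).map _) hassoc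
  rw [map_cosPoly] at heq
  have h0 := minpoly.aeval ℚ (4 * Real.cos (Real.pi / m) ^ 2)
  rw [← heq, aeval_X] at h0
  have hm' : (3 : ℝ) ≤ m := by exact_mod_cast hm
  have hcos : 0 < Real.cos (Real.pi / m) := by
    refine Real.cos_pos_of_mem_Ioo ⟨?_, ?_⟩
    · have : 0 < Real.pi / m := by positivity
      linarith [Real.pi_pos]
    · exact div_lt_div_of_pos_left Real.pi_pos (by norm_num) (by linarith)
  exact (by positivity : 4 * Real.cos (Real.pi / m) ^ 2 ≠ 0) h0

/-- The injective endomorphisms of a ring. -/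
abbrev InjEnd (R : Type*) [CommRing R] : Type _ := {σ : R →+* R // Function.Injective σ}

/-- The substitutions of `X ^ (k + 1)` for `X` are injective and send `X ^ 2` to different powers.
-/
theorem exists_injEnd_X (n : ℕ) : ∃ F : Finset (InjEnd (AlgebraicClosure ℚ)[X]), F.card = n ∧
    Set.InjOn (fun σ : InjEnd (AlgebraicClosure ℚ)[X] => σ.1 X ^ 2) F := by
  classical
  let g : ℕ → InjEnd (AlgebraicClosure ℚ)[X] := fun k =>
    ⟨(expand (AlgebraicClosure ℚ) (k + 1) : _ →+* _), expand_injective (Nat.succ_pos k)⟩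
  have hg : Function.Injective fun k => (g k).1 X ^ 2 := by
    intro k k' h
    have h' : (X ^ ((k + 1) * 2) : (AlgebraicClosure ℚ)[X]) = X ^ ((k' + 1) * 2) := by
      simpa [g, ← pow_mul] using h
    have := congrArg natDegree h'
    rw [natDegree_X_pow, natDegree_X_pow] at this
    omega
  have hg' : Function.Injective g := fun k k' h => hg (by simp only [h])
  refine ⟨(Finset.range n).image g, ?_, ?_⟩
  · rw [Finset.card_image_of_injective _ hg', Finset.card_range]
  · intro σ hσ σ' hσ' h
    obtain ⟨k, -, rfl⟩ := Finset.mem_image.1 hσ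
    obtain ⟨k', -, rfl⟩ := Finset.mem_image.1 hσ'
    rw [hg h]

theorem normal_algebraicClosure (k : Type*) [Field k] : Normal k (AlgebraicClosure k) :=
  IsAlgClosure.normal k _

/-- An irreducible rational polynomial is separable, and its roots are permuted transitively by the
automorphisms of the algebraic closure, which act on coefficients. -/
theorem exists_injEnd_C {p : ℚ[X]} (hp : Irreducible p) (hp' : p.Monic) {c : AlgebraicClosure ℚ}
    (hc : aeval (c ^ 2) p = 0) (n : ℕ) (hn : n ≤ p.natDegree) :
    ∃ F : Finset (InjEnd (AlgebraicClosure ℚ)[X]), F.card = n ∧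
      Set.InjOn (fun σ : InjEnd (AlgebraicClosure ℚ)[X] => σ.1 (C c) ^ 2) F := by
  classical
  have hmin : p = minpoly ℚ (c ^ 2) := minpoly.eq_of_irreducible_of_monic hp hc hp'
  have hcard : (p.rootSet (AlgebraicClosure ℚ)).toFinset.card = p.natDegree := by
    rw [Set.toFinset_card]
    exact card_rootSet_eq_natDegree hp.separable (IsAlgClosed.splits _)
  obtain ⟨Z, hZ, hZn⟩ := Finset.exists_subset_card_eq (hcard ▸ hn)
  have hσ : ∀ z : AlgebraicClosure ℚ, ∃ σ : AlgebraicClosure ℚ ≃ₐ[ℚ] AlgebraicClosure ℚ,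
      z ∈ Z → σ (c ^ 2) = z := by
    intro z
    by_cases hz : z ∈ Z
    · have hroot := hZ hz
      rw [Set.mem_toFinset, mem_rootSet] at hroot
      have hconj : IsConjRoot ℚ z (c ^ 2) := by
        rw [IsConjRoot, ← hmin]
        exact (minpoly.eq_of_irreducible_of_monic hp hroot.2 hp').symm
      have : Normal ℚ (AlgebraicClosure ℚ) := by
        convert normal_algebraicClosure ℚ
        exact Subsingleton.elim _ _
      obtain ⟨σ, hσ⟩ := isConjRoot_iff_exists_algEquiv.1 hconj
      exact ⟨σ, fun _ => hσ⟩
    · exact ⟨AlgEquiv.refl, fun h => absurd h hz⟩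
  choose σ hσ using hσ
  let g : AlgebraicClosure ℚ → InjEnd (AlgebraicClosure ℚ)[X] := fun z =>
    ⟨mapRingHom (σ z : AlgebraicClosure ℚ →+* AlgebraicClosure ℚ),
      map_injective _ (σ z).injective⟩
  have hg : ∀ z ∈ Z, (g z).1 (C c) ^ 2 = C z := by
    intro z hz
    have := hσ z hz
    simp only [g, coe_mapRingHom, map_C]
    rw [← C_pow, ← map_pow]
    exact congrArg C this
  refine ⟨Z.image g, ?_, ?_⟩
  · rw [Finset.card_image_of_injOn, hZn]
    intro z hz z' hz' h
    refine C_injective ?_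
    rw [← hg z hz, ← hg z' hz', h]
  · intro τ hτ τ' hτ' h
    obtain ⟨z, hz, rfl⟩ := Finset.mem_image.1 hτ
    obtain ⟨z', hz', rfl⟩ := Finset.mem_image.1 hτ'
    rw [C_injective ((hg z hz).symm.trans (h.trans (hg z' hz')))]

theorem exists_separated_coefficient (m : ℕ) (hm : 3 ≤ m ∨ m = 0) :
    ∃ b : (AlgebraicClosure ℚ)[X], b ≠ 0 ∧ (3 ≤ m → aeval (b ^ 2) (cosPoly m) = 0) ∧
      ∀ n : ℕ, (3 ≤ m → n ≤ (cosPoly m).natDegree) →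
        ∃ F : Finset (InjEnd (AlgebraicClosure ℚ)[X]), F.card = n ∧
          Set.InjOn (fun σ : InjEnd (AlgebraicClosure ℚ)[X] => σ.1 b ^ 2) F := by
  rcases hm with hm | rfl
  · have hirr := irreducible_map_cosPoly m
    obtain ⟨z, hz⟩ := IsAlgClosed.exists_aeval_eq_zero (AlgebraicClosure ℚ)
      ((cosPoly m).map (algebraMap ℤ ℚ)) hirr.degree_pos.ne'
    -- A single edge receives the coefficient and `[iji]` its square, so a square root of the root
    -- is needed.
    obtain ⟨c, rfl⟩ := IsAlgClosed.exists_pow_nat_eq z (n := 2) (by norm_num)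
    refine ⟨C c, ?_, fun _ => ?_, fun n hn => ?_⟩
    · rw [Ne, C_eq_zero]
      rintro rfl
      refine not_X_dvd_map_cosPoly hm ?_
      rw [X_dvd_iff]
      have : algebraMap ℚ (AlgebraicClosure ℚ) (((cosPoly m).map (algebraMap ℤ ℚ)).coeff 0) = 0 := by
        rw [← hz, zero_pow two_ne_zero, ← coeff_zero_eq_aeval_zero']
      exact (map_eq_zero _).1 this
    · rw [aeval_map_algebraMap] at hz
      rw [← C_pow, ← algebraMap_eq, aeval_algebraMap_apply, hz, map_zero]
    · refine exists_injEnd_C hirr ((cosPoly_monic m).map _) hz n ?_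
      rw [(cosPoly_monic m).natDegree_map]
      exact hn hm
  · exact ⟨X, X_ne_zero, by simp, fun n _ => exists_injEnd_X n⟩

end

/-! ### Paths as lists of vertices -/

noncomputable section

namespace GraphPath

variable {V : Type*} {G : SimpleGraph V}

/-- The list of all vertices of a path other than the first one. -/
def tail (p : GraphPath G) : List V := p.walk.support.tail

theorem cons_tail (p : GraphPath G) : p.source :: p.tail = p.walk.support :=
  p.walk.cons_tail_support

theorem getLast_cons_tail (p : GraphPath G) : (p.source :: p.tail).getLast (by simp) = p.target := by
  simp only [cons_tail, SimpleGraph.Walk.getLast_support]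

theorem tail_concat (p q : GraphPath G) (h : p.target = q.source) :
    (p.concat q h).tail = p.tail ++ q.tail := by
  simp [tail, concat, SimpleGraph.Walk.tail_support_append]

theorem isChain_cons_tail (p : GraphPath G) : (p.source :: p.tail).IsChain G.Adj := by
  rw [cons_tail]
  exact p.walk.isChain_adj_support

theorem eq_of_tail_eq {p q : GraphPath G} (hs : p.source = q.source) (ht : p.target = q.target)
    (h : p.tail = q.tail) : p = q := by
  obtain ⟨a, b, p⟩ := p
  obtain ⟨c, e, q⟩ := q
  dsimp only at hs ht
  subst hs ht
  congr 1
  apply SimpleGraph.Walk.ext_support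
  rw [← p.cons_tail_support, ← q.cons_tail_support]
  exact congrArg _ h

/-- The path of length one along an edge. -/
def edge {u v : V} (h : G.Adj u v) : GraphPath G := ⟨u, v, h.toWalk⟩

theorem edge_concat_tail {u : V} (p : GraphPath G) (h : G.Adj u p.source) :
    ((edge h).concat p rfl).tail = p.source :: p.tail :=
  tail_concat (edge h) p rfl

end GraphPath

namespace PathAlgebra

variable {A : Type*} [CommRing A] {V : Type*} {G : SimpleGraph V}

theorem single_mul_single_of_eq (p q : GraphPath G) (a b : A) (h : p.target = q.source) :
    single p a * single q b = single (p.concat q h) (a * b) := by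
  rw [single_mul_single, mulSingle_of_eq _ _ _ _ h]

theorem single_mul_single_of_ne (p q : GraphPath G) (a b : A) (h : p.target ≠ q.source) :
    single p a * single q b = 0 := by
  rw [single_mul_single, mulSingle_of_ne _ _ _ _ h]

theorem single_vertex_mul_single (p : GraphPath G) (a b : A) :
    single (GraphPath.vertex p.source) a * single p b = single p (a * b) := by
  rw [single_mul_single_of_eq _ _ _ _ rfl, GraphPath.vertex_concat]

theorem single_mul_vertex (p : GraphPath G) (a : A) :
    single p a * vertex A p.target = single p a := by
  rw [vertex, single_mul_single_of_eq _ _ _ _ rfl, GraphPath.concat_vertex, mul_one]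

theorem single_mul_vertex_of_ne (p : GraphPath G) (a : A) {v : V} (h : p.target ≠ v) :
    single p a * vertex A v = 0 :=
  single_mul_single_of_ne _ _ _ _ h

theorem vertex_mul_single_of_ne (p : GraphPath G) (a : A) {v : V} (h : v ≠ p.source) :
    vertex A v * single p a = 0 :=
  single_mul_single_of_ne _ _ _ _ h

open scoped Classical in
variable (A G) in
/-- The path with initial vertex `i` whose other vertices are listed, as an element of the path
algebra. It is zero if two consecutive vertices are not adjacent. -/
def ofList : V → List V → PathAlgebra A G
  | i, [] => vertex A i
  | i, j :: l => (if h : G.Adj i j then single (GraphPath.edge h) 1 else 0) * ofList j l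

theorem vertex_mul_ofList (i : V) (l : List V) : vertex A i * ofList A G i l = ofList A G i l := by
  cases l with
  | nil => exact isIdempotentElem_vertex i
  | cons j l =>
    rw [ofList, ← mul_assoc]
    split_ifs with h
    · congr 1
      rw [vertex]
      exact (single_vertex_mul_single (GraphPath.edge h) 1 1).trans (by rw [mul_one])
    · simp

theorem ofList_append (i : V) (l l' : List V) :
    ofList A G i (l ++ l') = ofList A G i l * ofList A G ((i :: l).getLast (by simp)) l' := by
  induction l generalizing i with
  | nil => exact (vertex_mul_ofList i l').symm
  | cons j l ih =>
    rw [List.cons_append, ofList, ih, ofList, mul_assoc]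
    simp

theorem exists_ofList_eq_single {i : V} {l : List V} (h : (i :: l).IsChain G.Adj) :
    ∃ p : GraphPath G, p.source = i ∧ p.tail = l ∧ ofList A G i l = single p 1 := by
  induction l generalizing i with
  | nil => exact ⟨GraphPath.vertex i, rfl, rfl, rfl⟩
  | cons j l ih =>
    rw [List.isChain_cons_cons] at h
    obtain ⟨p, rfl, rfl, hp⟩ := ih h.2
    refine ⟨(GraphPath.edge h.1).concat p rfl, rfl, GraphPath.edge_concat_tail p h.1, ?_⟩
    rw [ofList, dif_pos h.1, hp, single_mul_single_of_eq _ _ _ _ rfl, mul_one]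

theorem ofList_eq_zero {i : V} {l : List V} (h : ¬ (i :: l).IsChain G.Adj) :
    ofList A G i l = 0 := by
  induction l generalizing i with
  | nil => simp at h
  | cons j l ih =>
    rw [ofList]
    split_ifs with hij
    · rw [ih fun h' => h (List.isChain_cons_cons.2 ⟨hij, h'⟩), mul_zero]
    · rw [zero_mul]

theorem single_eq_mul_ofList (p : GraphPath G) (a : A) :
    single p a = single (GraphPath.vertex p.source) a * ofList A G p.source p.tail := by
  obtain ⟨q, hs, ht, hq⟩ := exists_ofList_eq_single (A := A) p.isChain_cons_tail
  have htarget : q.target = p.target := by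
    rw [← q.getLast_cons_tail, ← p.getLast_cons_tail]
    simp only [hs, ht]
  obtain rfl := GraphPath.eq_of_tail_eq hs htarget ht
  rw [hq, single_vertex_mul_single, mul_one]

theorem backtrack_mul_ofList {u v : V} (h : G.Adj u v) (l : List V) :
    backtrack A h * ofList A G u l = ofList A G u (v :: u :: l) := by
  rw [ofList, ofList, dif_pos h, dif_pos h.symm, ← mul_assoc,
    single_mul_single_of_eq _ _ _ _ rfl, mul_one]
  rfl

theorem cornerBacktrack_pow {u v : V} (h : G.Adj u v) (k : ℕ) :
    (cornerBacktrack A h ^ k).val = ofList A G u (alternating u v (2 * k)) := by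
  induction k with
  | zero => rfl
  | succ k ih =>
    rw [pow_succ', Nat.mul_succ, alternating, alternating, ← backtrack_mul_ofList h, ← ih]
    rfl

/-- Powers in the corner ring are alternating paths, the zeroth one being the identity `[u]`. -/
theorem evalBacktrack_eq_sum {u v : V} (h : G.Adj u v) (f : Polynomial ℤ) :
    evalBacktrack h f = ∑ k ∈ Finset.range (f.natDegree + 1),
      f.coeff k • ofList A G u (alternating u v (2 * k)) := by
  let φ : (isIdempotentElem_vertex u : IsIdempotentElem (vertex A u : PathAlgebra A G)).Corner →+
      PathAlgebra A G := { toFun := fun x => x.val, map_zero' := rfl, map_add' := fun _ _ => rfl }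
  change φ (Polynomial.aeval (cornerBacktrack A h) f) = _
  rw [Polynomial.aeval_eq_sum_range, map_sum]
  refine Finset.sum_congr rfl fun k _ => ?_
  rw [map_zsmul, ← cornerBacktrack_pow h]
  rfl

end PathAlgebra

end

/-! ### Evaluating the path algebra in the series ring -/

noncomputable section

namespace SkewSeries

theorem mul_const_apply {S R : Type*} [CommRing R] {τ : S → R →+* R} (u : SkewSeries τ) (a : R)
    (w : List S) : (u * const τ a) w = u w * a := by
  induction w generalizing u with
  | nil => rfl
  | cons s w ih => rw [mul_cons, ih]; simp

/-- Every ring endomorphism fixes the image of `ℚ`, so rational scalars are central even though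
general constants are not. -/
theorem commute_const_algebraMap {S R : Type*} [CommRing R] [Algebra ℚ R] {τ : S → R →+* R}
    (u : SkewSeries τ) (a : ℚ) : Commute u (const τ (algebraMap ℚ R a)) := by
  ext w
  have : (twist τ w) (algebraMap ℚ R a) = algebraMap ℚ R a := by
    rw [← RingHom.comp_apply]
    exact congrArg (fun f : ℚ →+* R => f a) (Subsingleton.elim _ _)
  rw [mul_const_apply, const_mul_apply, this, mul_comm]

end SkewSeries

namespace PathAlgebra

open SkewSeries

variable {V T R : Type*} [CommRing R] [Algebra ℚ R] (τ : T → R →+* R) (b : V → V → R)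
  {G : SimpleGraph V}

open scoped Classical in
/-- The series of `a • p` if the path `p` runs from `i` to `k`, and zero otherwise. -/
def entryTerm (i k : V) (p : GraphPath G) (a : ℚ) : SkewSeries (dartTwist (V := V) τ) :=
  if p.source = i ∧ p.target = k then
    pathSeries τ b p.source p.tail * const _ (algebraMap ℚ R a) else 0

variable {τ b} in
theorem entryTerm_zero (i k : V) (p : GraphPath G) : entryTerm τ b i k p 0 = 0 := by
  have : const (dartTwist (V := V) τ) (algebraMap ℚ R 0) = 0 :=
    map_zero ((constHom _).comp (algebraMap ℚ R))
  rw [entryTerm, this, mul_zero, ite_self]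

variable {τ b} in
theorem entryTerm_add (i k : V) (p : GraphPath G) (a c : ℚ) :
    entryTerm τ b i k p (a + c) = entryTerm τ b i k p a + entryTerm τ b i k p c := by
  have : const (dartTwist (V := V) τ) (algebraMap ℚ R (a + c)) =
      const _ (algebraMap ℚ R a) + const _ (algebraMap ℚ R c) :=
    map_add ((constHom _).comp (algebraMap ℚ R)) a c
  unfold entryTerm
  split_ifs
  · rw [this, mul_add]
  · rw [add_zero]

/-- The sum of the series of those paths in an element of the path algebra which run from `i` to
`k`. -/
def entry (i k : V) : PathAlgebra ℚ G →+ SkewSeries (dartTwist (V := V) τ) where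
  toFun f := (coeffs ℚ G f).sum (entryTerm τ b i k)
  map_zero' := by simp
  map_add' f g := by
    rw [map_add]
    exact Finsupp.sum_add_index' (entryTerm_zero i k) (entryTerm_add i k)

variable {τ b}

theorem entry_single_eq_entryTerm (i k : V) (p : GraphPath G) (a : ℚ) :
    entry τ b i k (single p a) = entryTerm τ b i k p a := by
  change (coeffs ℚ G (single p a)).sum (entryTerm τ b i k) = _
  rw [single, LinearEquiv.apply_symm_apply, Finsupp.sum_single_index (entryTerm_zero i k p)]

theorem entry_single (p : GraphPath G) (a : ℚ) :
    entry τ b p.source p.target (single p a) =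
      pathSeries τ b p.source p.tail * const _ (algebraMap ℚ R a) := by
  rw [entry_single_eq_entryTerm, entryTerm, if_pos ⟨rfl, rfl⟩]

theorem entry_single_of_ne (p : GraphPath G) (a : ℚ) {i k : V}
    (h : ¬ (p.source = i ∧ p.target = k)) : entry τ b i k (single p a) = 0 := by
  rw [entry_single_eq_entryTerm, entryTerm, if_neg h]

theorem entry_eq_sum (i k : V) (f : PathAlgebra ℚ G)
    (hf : ∀ p ∈ (coeffs ℚ G f).support, p.source = i ∧ p.target = k) :
    entry τ b i k f = ∑ p ∈ (coeffs ℚ G f).support,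
      pathSeries τ b i p.tail * const _ (algebraMap ℚ R (coeffs ℚ G f p)) := by
  refine Finset.sum_congr rfl fun p hp => ?_
  rw [entryTerm, if_pos (hf p hp), (hf p hp).1]

theorem entry_single_mul_single (p q : GraphPath G) (a c : ℚ) (k : V) :
    entry τ b p.source k (single p a * single q c) =
      entry τ b p.source p.target (single p a) * entry τ b p.target k (single q c) := by
  by_cases h : p.target = q.source
  · rw [single_mul_single_of_eq _ _ _ _ h]
    by_cases hk : q.target = k
    · subst hk
      have h1 := entry_single (τ := τ) (b := b) (p.concat q h) (a * c)
      have h2 := entry_single (τ := τ) (b := b) q c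
      rw [← h] at h2
      have h3 : ∀ l, pathSeries τ b p.source (p.tail ++ l) =
          pathSeries τ b p.source p.tail * pathSeries τ b p.target l := by
        intro l
        rw [pathSeries_append, p.getLast_cons_tail]
      rw [GraphPath.tail_concat] at h1
      refine h1.trans ?_
      rw [h2, entry_single, map_mul, ← const_mul_const]
      refine (congrArg (· * _) (h3 q.tail)).trans ?_
      have := commute_const_algebraMap (pathSeries τ b p.target q.tail) a
      simp only [mul_assoc]
      rw [← mul_assoc (const _ _) (pathSeries _ _ _ _), ← this.eq, mul_assoc]
    · rw [entry_single_of_ne q _ fun h' => hk h'.2, mul_zero]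
      exact entry_single_of_ne _ _ fun h' => hk h'.2
  · rw [single_mul_single_of_ne _ _ _ _ h, map_zero, entry_single_of_ne q c fun h' => h h'.1.symm,
      mul_zero]

theorem entry_single_mul (p : GraphPath G) (a : ℚ) (f : PathAlgebra ℚ G) (k : V) :
    entry τ b p.source k (single p a * f) =
      entry τ b p.source p.target (single p a) * entry τ b p.target k f := by
  induction f using induction_on with
  | zero => simp
  | add f g hf hg => rw [mul_add, map_add, hf, hg, map_add, mul_add]
  | single q c => exact entry_single_mul_single p q a c k

theorem entry_single_mul_of_ne (p : GraphPath G) (a : ℚ) (f : PathAlgebra ℚ G) {i : V}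
    (h : p.source ≠ i) (k : V) : entry τ b i k (single p a * f) = 0 := by
  induction f using induction_on with
  | zero => simp
  | add f g hf hg => rw [mul_add, map_add, hf, hg, add_zero]
  | single q c =>
    by_cases hpq : p.target = q.source
    · rw [single_mul_single_of_eq _ _ _ _ hpq]
      exact entry_single_of_ne _ _ fun h' => h h'.1
    · rw [single_mul_single_of_ne _ _ _ _ hpq, map_zero]

/-- This is matrix multiplication in which the idempotent at `j` leaves only one intermediate
vertex. Hence a product of pieces becomes a single product of series. -/
theorem entry_mul_vertex_mul (f g : PathAlgebra ℚ G) (i j k : V) :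
    entry τ b i k (f * vertex ℚ j * g) = entry τ b i j f * entry τ b j k g := by
  induction f using induction_on with
  | zero => simp
  | add f f' hf hf' => simp only [add_mul, map_add, hf, hf']
  | single p a =>
    by_cases hi : p.source = i
    · subst hi
      by_cases hj : p.target = j
      · subst hj
        rw [single_mul_vertex, entry_single_mul]
      · rw [single_mul_vertex_of_ne _ _ hj, entry_single_of_ne _ _ fun h => hj h.2, zero_mul,
          zero_mul, map_zero]
    · rw [mul_assoc, entry_single_mul_of_ne _ _ _ hi, entry_single_of_ne _ _ fun h => hi h.1,
        zero_mul]

theorem entry_mul_single (f : PathAlgebra ℚ G) (q : GraphPath G) (c : ℚ) (i k : V) :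
    entry τ b i k (f * single q c) = entry τ b i q.source f * entry τ b q.source k (single q c) := by
  rw [← entry_mul_vertex_mul, mul_assoc, vertex, single_vertex_mul_single, one_mul]

variable (τ b G) in
/-- The two-sided ideal of all elements of the path algebra whose entries vanish. -/
def entryIdeal : TwoSidedIdeal (PathAlgebra ℚ G) :=
  TwoSidedIdeal.mk' {f | ∀ i k, entry τ b i k f = 0} (fun i k => map_zero _)
    (fun {f g} hf hg i k => by rw [map_add, hf, hg, add_zero])
    (fun {f} hf i k => by rw [map_neg, hf, neg_zero])
    (fun {x f} hf i k => by
      induction x using induction_on with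
      | zero => simp
      | add x y hx hy => rw [add_mul, map_add, hx, hy, add_zero]
      | single p a =>
        by_cases hi : p.source = i
        · rw [← hi, entry_single_mul, hf, mul_zero]
        · exact entry_single_mul_of_ne _ _ _ hi k)
    (fun {f x} hf i k => by
      induction x using induction_on with
      | zero => simp
      | add x y hx hy => rw [mul_add, map_add, hx, hy, add_zero]
      | single q c => rw [entry_mul_single, hf, zero_mul])

theorem mem_entryIdeal {f : PathAlgebra ℚ G} :
    f ∈ entryIdeal τ b G ↔ ∀ i k, entry τ b i k f = 0 := by
  rw [entryIdeal, TwoSidedIdeal.mem_mk']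
  rfl

open scoped Classical in
theorem entry_ofList {i : V} {l : List V} (h : (i :: l).IsChain G.Adj) (x y : V) :
    entry τ b x y (ofList ℚ G i l) =
      if i = x ∧ (i :: l).getLast (by simp) = y then pathSeries τ b i l else 0 := by
  obtain ⟨p, rfl, rfl, hp⟩ := exists_ofList_eq_single (A := ℚ) h
  rw [hp, p.getLast_cons_tail]
  split_ifs with hxy
  · obtain ⟨rfl, rfl⟩ := hxy
    rw [entry_single, map_one, ← one_def, mul_one]
  · exact entry_single_of_ne _ _ hxy

theorem isChain_cons_alternating {u v : V} (h : G.Adj u v) (n : ℕ) :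
    (u :: alternating u v n).IsChain G.Adj := by
  induction n generalizing u v with
  | zero => simp [alternating]
  | succ n ih => exact List.isChain_cons_cons.2 ⟨h, ih h.symm⟩

theorem getLast_cons_alternating (u v : V) (k : ℕ) :
    (u :: alternating u v (2 * k)).getLast (by simp) = u := by
  induction k with
  | zero => rfl
  | succ k ih => simpa only [Nat.mul_succ, alternating, List.getLast_cons_cons] using ih

/-- All powers of `[uvu]` become powers of `(b u v)²` conjugated by the same geometric series, so
the only nontrivial entry is the conjugate of the value of `f` at `(b u v)²`. -/
theorem evalBacktrack_mem_entryIdeal (hb : ∀ i j, b i j = b j i) {u v : V} (h : G.Adj u v)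
    (f : Polynomial ℤ) (hf : Polynomial.aeval (b u v ^ 2) f = 0) :
    evalBacktrack h f ∈ entryIdeal τ b G := by
  classical
  rw [mem_entryIdeal]
  intro x y
  have key : ∀ k, entry τ b x y (ofList ℚ G u (alternating u v (2 * k))) =
      if u = x ∧ u = y then geom (dartTwist τ) {s : (V × V) × T | s.1 = (u, v)} *
        constHom _ ((b u v ^ 2) ^ k) * geomInv _ {s | s.1 = (u, v)} else 0 := by
    intro k
    rw [entry_ofList (isChain_cons_alternating h _), getLast_cons_alternating]
    congr 1
    have := pathSeries_alternating_append (τ := τ) hb u v (2 * k) []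
    rw [List.append_nil, pow_mul] at this
    rw [this, lastDart, if_pos (even_two_mul k)]
    exact mul_one _
  rw [evalBacktrack_eq_sum, map_sum]
  simp only [map_zsmul, key]
  split_ifs
  · have hterm : ∀ k (g g' : SkewSeries (dartTwist (V := V) τ)), f.coeff k •
        (g * constHom _ ((b u v ^ 2) ^ k) * g') =
          g * constHom _ (f.coeff k • (b u v ^ 2) ^ k) * g' := by
      intro k g g'
      rw [map_zsmul, mul_smul_comm, smul_mul_assoc]
    simp only [hterm]
    rw [← Finset.sum_mul, ← Finset.mul_sum, ← map_sum, ← Polynomial.aeval_eq_sum_range, hf,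
      map_zero, mul_zero, zero_mul]
  · simp

theorem eq_zero_of_entry_eq_zero [IsDomain R] {d : V → V → ℕ∞}
    (hτ : ∀ t, Function.Injective (τ t))
    (hb : ∀ i j, b i j = b j i) (hb0 : ∀ i j, G.Adj i j → b i j ≠ 0)
    (sep : ∀ i j, G.Adj i j → ∀ n : ℕ, (n : ℕ∞) ≤ d i j →
      ∃ F : Finset T, F.card = n ∧ Set.InjOn (fun t => τ t (b i j) ^ 2) F)
    (i k : V) (f : PathAlgebra ℚ G)
    (hf : ∀ p ∈ (coeffs ℚ G f).support, p.source = i ∧ p.target = k)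
    (hred : ∀ p ∈ (coeffs ℚ G f).support, IsReducedPath G d p.source p.tail)
    (h : entry τ b i k f = 0) : f = 0 := by
  classical
  set P := (coeffs ℚ G f).support with hP
  by_contra hf0
  have hPne : P.Nonempty := by
    rw [Finset.nonempty_iff_ne_empty, hP, Ne, Finsupp.support_eq_empty]
    simpa using hf0
  -- If the element were nonzero, a path in its support with the most runs would have coefficient
  -- zero by the independence lemma.
  obtain ⟨q, hq, hmax⟩ := P.exists_max_image (fun p => runCount i p.tail) hPne
  have hinj : ∀ p ∈ P, ∀ p' ∈ P, p.tail = p'.tail → p = p' := fun p hp p' hp' hpp' =>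
    GraphPath.eq_of_tail_eq ((hf p hp).1.trans (hf p' hp').1.symm)
      ((hf p hp).2.trans (hf p' hp').2.symm) hpp'
  -- With both endpoints fixed, a path is determined by its list of vertices, so this sum has at
  -- most one term.
  let a : List V → R := fun l => ∑ p ∈ P with p.tail = l, algebraMap ℚ R (coeffs ℚ G f p)
  have ha : ∀ p ∈ P, a p.tail = algebraMap ℚ R (coeffs ℚ G f p) := by
    intro p hp
    have : P.filter (fun p' => p'.tail = p.tail) = {p} := by
      ext p'
      rw [Finset.mem_filter, Finset.mem_singleton]
      exact ⟨fun h => hinj p' h.1 p hp h.2, fun h => by rw [h]; exact ⟨hp, rfl⟩⟩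
    simp only [a, this, Finset.sum_singleton]
  have := eq_zero_of_sum_pathSeries_apply_eq_zero hτ hb hb0 sep (runCount i q.tail) ∅ i
    (P.image GraphPath.tail) a ?_ ?_ q.tail (Finset.mem_image_of_mem _ hq) rfl (by simp)
  · rw [ha q hq, map_eq_zero_iff _ (algebraMap ℚ R).injective] at this
    exact (Finsupp.mem_support_iff.1 hq) this
  · intro l hl
    obtain ⟨p, hp, rfl⟩ := Finset.mem_image.1 hl
    refine ⟨?_, hmax p hp⟩
    rw [← (hf p hp).1]
    exact hred p hp
  · intro w _ _
    rw [Finset.sum_image fun p hp p' hp' => hinj p hp p' hp']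
    rw [entry_eq_sum i k f hf] at h
    have := congrArg (fun u : SkewSeries (dartTwist (V := V) τ) => u w) h
    rw [apply_sum, SkewSeries.zero_apply] at this
    rw [← this]
    refine Finset.sum_congr rfl fun p hp => ?_
    rw [ha p hp, mul_const_apply]

end PathAlgebra

end

/-! ### Reduced representatives and the conclusion -/

noncomputable section

open PathAlgebra

namespace CoxeterMatrix

variable {B : Type*} (M : CoxeterMatrix B)

open scoped Classical in
/-- The degree of the relation attached to an edge, which is infinite if there is no relation. -/
def relDegree (i j : B) : ℕ∞ := if 3 ≤ M i j then ((cosPoly (M i j)).natDegree : ℕ∞) else ⊤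

variable {A : Type*} [CommRing A]

/-- All paths occurring in an element of the path algebra are reduced. -/
def IsReduced (f : PathAlgebra A M.graph) : Prop :=
  ∀ p ∈ (coeffs A M.graph f).support, IsReducedPath M.graph M.relDegree p.source p.tail

variable {M}

theorem isReduced_zero : M.IsReduced (0 : PathAlgebra A M.graph) := by
  intro p hp
  simp at hp

theorem IsReduced.add {f g : PathAlgebra A M.graph} (hf : M.IsReduced f) (hg : M.IsReduced g) :
    M.IsReduced (f + g) := by
  classical
  intro p hp
  rw [map_add] at hp
  rcases Finset.mem_union.1 (Finsupp.support_add hp) with h | h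
  · exact hf p h
  · exact hg p h

theorem IsReduced.neg {f : PathAlgebra A M.graph} (hf : M.IsReduced f) : M.IsReduced (-f) := by
  intro p hp
  rw [map_neg, Finsupp.support_neg] at hp
  exact hf p hp

theorem isReduced_single {p : GraphPath M.graph}
    (hp : IsReducedPath M.graph M.relDegree p.source p.tail) (a : A) :
    M.IsReduced (single p a) := by
  intro q hq
  rw [single, LinearEquiv.apply_symm_apply] at hq
  obtain rfl := Finset.mem_singleton.1 (Finsupp.support_single_subset hq)
  exact hp

variable (M A) in
/-- The elements of the path algebra which are congruent modulo the relations to a linear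
combination of reduced paths. -/
def reducible : AddSubgroup (PathAlgebra A M.graph) where
  carrier := {f | ∃ g, M.IsReduced g ∧ f - g ∈ M.relIdeal A}
  zero_mem' := ⟨0, isReduced_zero, by rw [sub_zero]; exact zero_mem _⟩
  add_mem' := by
    rintro f f' ⟨g, hg, h⟩ ⟨g', hg', h'⟩
    exact ⟨g + g', hg.add hg', by rw [add_sub_add_comm]; exact add_mem h h'⟩
  neg_mem' := by
    rintro f ⟨g, hg, h⟩
    exact ⟨-g, hg.neg, by rw [← neg_sub']; exact neg_mem h⟩

theorem mem_reducible_of_mem {f : PathAlgebra A M.graph} (hf : f ∈ M.relIdeal A) :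
    f ∈ M.reducible A := ⟨0, isReduced_zero, by rwa [sub_zero]⟩

theorem evalBacktrack_mem_relIdeal {u v : B} (h : 3 ≤ M u v) :
    evalBacktrack (M.graph_adj_of_three_le h) (cosPoly (M u v)) ∈ M.relIdeal A :=
  TwoSidedIdeal.subset_span ⟨u, v, h, rfl⟩

theorem exists_append_eq_of_cons_infix {i u : B} {l r : List B} (h : (u :: r) <:+: (i :: l)) :
    ∃ s t : List B, (i :: s).getLast (by simp) = u ∧ l = s ++ (r ++ t) := by
  obtain ⟨s, t, h⟩ := h
  cases s with
  | nil =>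
    rw [List.nil_append, List.cons_append, List.cons.injEq] at h
    exact ⟨[], t, by simp [h.1], by simp [h.2]⟩
  | cons x s =>
    rw [List.cons_append, List.cons_append, List.cons.injEq] at h
    exact ⟨s ++ [u], t, by simp, by simp [← h.2]⟩

theorem length_alternating (i j : B) (n : ℕ) : (alternating i j n).length = n := by
  induction n generalizing i j with
  | zero => rfl
  | succ n ih => rw [alternating, List.length_cons, ih]

/-- A nonreduced path contains the leading term of some relation. The relation is monic, so it
replaces the path by an integral combination of strictly shorter ones, and induction on the length
applies. -/
theorem mul_ofList_mem_reducible (n : ℕ) (i : B) (l : List B) (hl : l.length = n) (a : A) :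
    single (GraphPath.vertex i) a * ofList A M.graph i l ∈ M.reducible A := by
  induction n using Nat.strong_induction_on generalizing l with
  | _ n ih =>
  by_cases hchain : (i :: l).IsChain M.graph.Adj
  swap
  · rw [ofList_eq_zero hchain, mul_zero]
    exact zero_mem _
  by_cases hred : IsReducedPath M.graph M.relDegree i l
  · obtain ⟨p, rfl, rfl, hp⟩ := exists_ofList_eq_single (A := A) hchain
    rw [hp, single_vertex_mul_single]
    exact ⟨_, isReduced_single hred _, by rw [sub_self]; exact zero_mem _⟩
  have : ∃ u v, ∃ d : ℕ, M.relDegree u v = d ∧ (u :: alternating u v (2 * d)) <:+: (i :: l) := by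
    by_contra! h
    exact hred ⟨hchain, h⟩
  obtain ⟨u, v, d, hd, hinfix⟩ := this
  obtain ⟨s, t, hs, rfl⟩ := exists_append_eq_of_cons_infix hinfix
  have h3 : 3 ≤ M u v := by
    by_contra h3
    rw [relDegree, if_neg h3] at hd
    exact ENat.natCast_ne_top _ hd.symm
  obtain rfl : (cosPoly (M u v)).natDegree = d := by
    rw [relDegree, if_pos h3] at hd
    exact_mod_cast hd
  set f := cosPoly (M u v) with hf
  have hdecomp : ∀ k, ofList A M.graph i (s ++ (alternating u v (2 * k) ++ t)) =
      ofList A M.graph i s * ofList A M.graph u (alternating u v (2 * k)) *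
        ofList A M.graph u t := by
    intro k
    rw [ofList_append, hs, ofList_append, getLast_cons_alternating, mul_assoc]
  have heval := evalBacktrack_eq_sum (A := A) (M.graph_adj_of_three_le h3) f
  rw [Finset.sum_range_succ, (cosPoly_monic (M u v)).coeff_natDegree, one_smul,
    ← sub_eq_iff_eq_add'] at heval
  rw [hdecomp, ← heval, mul_sub, sub_mul, mul_sub, Finset.mul_sum, Finset.sum_mul, Finset.mul_sum]
  refine sub_mem (mem_reducible_of_mem ?_) (sum_mem fun k hk => ?_)
  · exact TwoSidedIdeal.mul_mem_left _ _ _ (TwoSidedIdeal.mul_mem_right _ _ _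
      (TwoSidedIdeal.mul_mem_left _ _ _ (evalBacktrack_mem_relIdeal h3)))
  · rw [mul_smul_comm, smul_mul_assoc, mul_smul_comm, ← hdecomp]
    refine zsmul_mem (ih _ ?_ _ rfl) _
    have := Finset.mem_range.1 hk
    simp only [← hl, List.length_append, length_alternating]
    omega

theorem mem_reducible (f : PathAlgebra A M.graph) : f ∈ M.reducible A := by
  induction f using PathAlgebra.induction_on with
  | zero => exact zero_mem _
  | add f g hf hg => exact add_mem hf hg
  | single p a =>
    rw [single_eq_mul_ofList]
    exact mul_ofList_mem_reducible _ _ _ rfl a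

theorem isReduced_vertex_mul_mul_vertex {f : PathAlgebra A M.graph} (hf : M.IsReduced f) (i j : B) :
    M.IsReduced (vertex A i * f * vertex A j) ∧
      ∀ p ∈ (coeffs A M.graph (vertex A i * f * vertex A j)).support,
        p.source = i ∧ p.target = j := by
  classical
  have key : vertex A i * f * vertex A j = (coeffs A M.graph).symm
      ((coeffs A M.graph f).filter fun p => p.source = i ∧ p.target = j) := by
    clear hf
    induction f using PathAlgebra.induction_on with
    | zero => rw [mul_zero, zero_mul, map_zero, Finsupp.filter_zero, map_zero]
    | add f g hf hg => rw [mul_add, add_mul, hf, hg, map_add, Finsupp.filter_add, map_add]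
    | single p a =>
      have hs : coeffs A M.graph (single p a) = Finsupp.single p a :=
        LinearEquiv.apply_symm_apply _ _
      rw [hs]
      by_cases hi : i = p.source
      · have h1 : vertex A i * single p a = single p a := by
          rw [hi, vertex, single_vertex_mul_single, one_mul]
        by_cases hj : p.target = j
        · rw [h1, ← hj, single_mul_vertex,
            Finsupp.filter_single_of_pos _ ⟨hi.symm, rfl⟩]
          rfl
        · rw [h1, single_mul_vertex_of_ne _ _ hj, Finsupp.filter_single_of_neg _ fun h => hj h.2,
            map_zero]
      · rw [vertex_mul_single_of_ne _ _ hi, zero_mul,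
          Finsupp.filter_single_of_neg _ fun h => hi h.1.symm, map_zero]
  rw [IsReduced, key, LinearEquiv.apply_symm_apply]
  constructor
  · intro p hp
    rw [Finsupp.support_filter, Finset.mem_filter] at hp
    exact hf p hp.1
  · intro p hp
    rw [Finsupp.support_filter, Finset.mem_filter] at hp
    exact hp.2

variable (M A) in
/-- The projection from the path algebra to the coefficient ring. -/
def proj (f : PathAlgebra A M.graph) : M.CoeffRing A := (f : (M.relIdeal A).ringCon.Quotient)

theorem proj_eq_proj_iff {f g : PathAlgebra A M.graph} :
    M.proj A f = M.proj A g ↔ f - g ∈ M.relIdeal A :=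
  ((M.relIdeal A).ringCon.eq).trans ((M.relIdeal A).rel_iff _ _)

theorem exists_isReduced_of_mem_piece {i j : B} {x : M.CoeffRing A} (hx : x ∈ M.piece A i j) :
    ∃ f : PathAlgebra A M.graph, x = M.proj A f ∧ f * vertex A j = f ∧ M.IsReduced f ∧
      ∀ p ∈ (coeffs A M.graph f).support, p.source = i ∧ p.target = j := by
  obtain ⟨r, rfl⟩ := hx
  obtain ⟨f, rfl⟩ : ∃ f, M.proj A f = r := Quotient.exists_rep r
  obtain ⟨g, hg, hfg⟩ := mem_reducible f
  refine ⟨vertex A i * g * vertex A j, ?_, ?_, isReduced_vertex_mul_mul_vertex hg i j⟩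
  · rw [← proj_eq_proj_iff] at hfg
    rw [hfg]
    rfl
  · rw [mul_assoc _ _ (vertex A j), (isIdempotentElem_vertex j : _ * _ = _)]

end CoxeterMatrix

theorem mainTheorem2 {B : Type*} (M : CoxeterMatrix B) (i j k : B)
    (x₁ x₂ : M.CoeffRing ℚ) (h₁ : x₁ ∈ M.piece ℚ i j) (h₂ : x₂ ∈ M.piece ℚ j k)
    (h : x₁ * x₂ = 0) : x₁ = 0 ∨ x₂ = 0 := by
  classical
  obtain ⟨f, rfl, hfj, hf, hf'⟩ := CoxeterMatrix.exists_isReduced_of_mem_piece h₁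
  obtain ⟨g, rfl, -, hg, hg'⟩ := CoxeterMatrix.exists_isReduced_of_mem_piece h₂
  choose c hc0 hcroot hcsep using exists_separated_coefficient
  -- The value `1` is only a filler for pairs that are not joined by an edge.
  let b : B → B → Polynomial (AlgebraicClosure ℚ) := fun i j =>
    if hm : 3 ≤ M i j ∨ M i j = 0 then c (M i j) hm else 1
  have hbadj : ∀ {i j} (hij : M.graph.Adj i j), b i j = c (M i j) hij.2 := fun hij => dif_pos hij.2
  have hbsymm : ∀ i j, b i j = b j i := by
    intro i j
    simp only [b, M.symmetric i j]
  let τ : InjEnd (Polynomial (AlgebraicClosure ℚ)) → _ := fun σ => σ.1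
  have hle : M.relIdeal ℚ ≤ entryIdeal τ b M.graph := by
    refine TwoSidedIdeal.span_le.2 ?_
    rintro _ ⟨u, v, h3, rfl⟩
    refine evalBacktrack_mem_entryIdeal hbsymm _ _ ?_
    rw [hbadj (M.graph_adj_of_three_le h3)]
    exact hcroot _ _ h3
  have hfg : f * g ∈ M.relIdeal ℚ := by
    rw [← sub_zero (f * g), ← CoxeterMatrix.proj_eq_proj_iff]
    exact h
  have hentry := mem_entryIdeal.1 (hle hfg) i k
  -- Writing `f` as `f * [j]` turns the vanishing entry of the product into a vanishing product of
  -- two series.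
  rw [← hfj, entry_mul_vertex_mul] at hentry
  have hzero : ∀ {i k} {f : PathAlgebra ℚ M.graph}, M.IsReduced f →
      (∀ p ∈ (coeffs ℚ M.graph f).support, p.source = i ∧ p.target = k) →
      entry τ b i k f = 0 → M.proj ℚ f = 0 := by
    intro i k f hf hf' h0
    have : f = 0 := by
      refine eq_zero_of_entry_eq_zero (d := M.relDegree) (fun σ => σ.2) hbsymm
        (fun i j hij => ?_) (fun i j hij n hn => ?_) i k f hf' hf h0
      · rw [hbadj hij]
        exact hc0 _ _
      · rw [hbadj hij]
        refine hcsep _ _ n fun h3 => ?_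
        rw [CoxeterMatrix.relDegree, if_pos h3] at hn
        exact_mod_cast hn
    rw [this]
    rfl
  rcases SkewSeries.eq_zero_or_eq_zero_of_mul_eq_zero (fun s => s.2.2) hentry with h0 | h0
  · exact Or.inl (hzero hf hf' h0)
  · exact Or.inr (hzero hg hg' h0)

end
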